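/- For an integer $n\ge 1$ let $[n]=\{1,\dots,n\}$. A full flag of $[n]$ is a chain $U=(U_1,\dots,U_n)$ of subsets of $[n]$ with $|U_i|=i$ and $U_i\subset U_{i+1}$. For $0<k<n$, the full-flag Johnson graph $FJ(n,k)$ has the full flags of $[n]$ as vertices, two full flags $U,V$ being adjacent if and only if $|\{i\in[n]:U_i\neq V_i\}|=k$. A permutation $\sigma\in S_n$ is $m$-reducible if $[n]$ can be partitioned into $m$ nonempty contiguous intervals $I_1,\dots,I_m$ with $\sigma(I_j)=I_j$ for all $j$, and maximally $m$-reducible if $m$ is the largest integer for which it is $m$-reducible. Let $\mathcal R_n(k)\subseteq S_n$ be the set of maximally $(n-k)$-reducible permutations; it is closed under inversion and omits the identity. For a subset $\Sigma\subseteq S_n$ that is closed under inversion and omits the identity, $\operatorname{Cay}(S_n,\Sigma)$ is the graph on $S_n$ in which $g,h$ are adjacent if and only if $h=\sigma g$ for some $\sigma\in\Sigma$, and the Schreier graph $\operatorname{Sch}(S_n,[n],\Sigma)$ has vertex set $[n]$ and one arc from $i$ to $j$ for each $\sigma\in\Sigma$ with $\sigma(i)=j$. The second-largest eigenvalue of a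 graph is the second entry in the non-increasing list of eigenvalues, with multiplicity, of its adjacency matrix. $\operatorname{Cay}(S_n,\Sigma)$ has the Aldous property if $\Sigma$ generates $S_n$ and the second-largest eigenvalues of $\operatorname{Cay}(S_n,\Sigma)$ and $\operatorname{Sch}(S_n,[n],\Sigma)$ are equal. Theorem. For every $n\ge 4$, the full-flag Johnson graph $FJ(n,2)$ has the Aldous property. That is, $FJ(n,2)\cong\operatorname{Cay}(S_n,\mathcal R_n(2))$, and $\operatorname{Cay}(S_n,\mathcal R_n(2))$ has the Aldous property. Moreover, the left cosets $V_i=(1\,i)\operatorname{Stab}_n(1)$, $1\le i\le n$, of the stabiliser of the point $1$ form an equitable partition of $\operatorname{Cay}(S_n,\mathcal R_n(2))$ whose quotient matrix $\mathsf Q_n$ (with $(i,j)$ entry the number of neighbours in $V_j$ of any vertex of $V_i$) is the adjacency matrix of $\operatorname{Sch}(S_n,[n],\mathcal R_n(2))$; hence the second-largest eigenvalue of $FJ(n,2)$ is that of $\mathsf Q_n$. -/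

import Mathlib

/-- A full flag of `[n]` (modelled as `Fin n`, so `U i` is the set usually written `U_{i+1}`):
a strictly increasing chain of subsets with `|U_{i+1}| = i + 1`. -/
def FullFlag (n : ℕ) : Type :=
  {U : Fin n → Finset (Fin n) // (∀ i, (U i).card = (i : ℕ) + 1) ∧ StrictMono U}

open Classical in
noncomputable instance FullFlag.instFintype (n : ℕ) : Fintype (FullFlag n) :=
  inferInstanceAs (Fintype
    {U : Fin n → Finset (Fin n) // (∀ i, (U i).card = (i : ℕ) + 1) ∧ StrictMono U})

/-- The full-flag Johnson graph: two (distinct) full flags of `[n]` are adjacent if and only if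
they differ in exactly `k` positions. Distinctness is automatic for `k ≠ 0`. -/
def fullFlagJohnsonGraph (n k : ℕ) : SimpleGraph (FullFlag n) where
  Adj U V := U ≠ V ∧ {i : Fin n | U.1 i ≠ V.1 i}.ncard = k
  symm := ⟨fun U V h => ⟨h.1.symm, by simpa only [ne_comm] using h.2⟩⟩
  loopless := ⟨fun _ h => h.1 rfl⟩

/-- `σ` is `m`-reducible: `[n]` can be partitioned into `m` (nonempty) contiguous intervals, each
mapped onto itself by `σ`. -/
def IsReducible {n : ℕ} (σ : Equiv.Perm (Fin n)) (m : ℕ) : Prop :=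
  ∃ P : Finpartition (Finset.univ : Finset (Fin n)), P.parts.card = m ∧
    ∀ I ∈ P.parts, (I : Set (Fin n)).OrdConnected ∧ σ '' (I : Set (Fin n)) = I

/-- `m` is the largest integer for which `σ` is `m`-reducible. -/
def IsMaximallyReducible {n : ℕ} (σ : Equiv.Perm (Fin n)) (m : ℕ) : Prop :=
  IsGreatest {l : ℕ | IsReducible σ l} m

/-- A subset of a group that omits the identity and is closed under inversion. -/
structure ConnectionSet (G : Type*) [Group G] where
  carrier : Set G
  one_notMem : (1 : G) ∉ carrier
  inv_mem : ∀ g ∈ carrier, g⁻¹ ∈ carrier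

/-- The Cayley graph `Cay(G, S)`: `g` and `h` are adjacent if and only if `h = σ g` for some
`σ ∈ S`. -/
def cayleyGraph {G : Type*} [Group G] (S : ConnectionSet G) : SimpleGraph G where
  Adj g h := ∃ σ ∈ S.carrier, h = σ * g
  symm := ⟨by
    rintro g h ⟨σ, hσ, rfl⟩
    exact ⟨σ⁻¹, S.inv_mem σ hσ, by group⟩⟩
  loopless := ⟨by
    rintro g ⟨σ, hσ, h⟩
    have h1 : σ = 1 := by simpa using h.symm
    exact S.one_notMem (h1 ▸ hσ)⟩

theorem isReducible_one (n : ℕ) : IsReducible (1 : Equiv.Perm (Fin n)) n := by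
  refine ⟨⊥, by simp, ?_⟩
  intro I hI
  rw [Finpartition.mem_bot_iff] at hI
  obtain ⟨a, -, rfl⟩ := hI
  refine ⟨?_, by simp⟩
  rw [Finset.coe_singleton]
  exact Set.ordConnected_singleton

theorem IsReducible.inv {n m : ℕ} {σ : Equiv.Perm (Fin n)} (h : IsReducible σ m) :
    IsReducible σ⁻¹ m := by
  obtain ⟨P, hP, h⟩ := h
  refine ⟨P, hP, fun I hI => ⟨(h I hI).1, ?_⟩⟩
  have h2 := (h I hI).2
  conv_lhs => rw [← h2]
  rw [← Set.image_comp]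
  simp

/-- `R_n(k)`: the set of maximally `(n - k)`-reducible permutations of `[n]`. -/
def reducibleSet (n k : ℕ) (hk : 0 < k) (hkn : k < n) : ConnectionSet (Equiv.Perm (Fin n)) where
  carrier := {σ | IsMaximallyReducible σ (n - k)}
  one_notMem := by
    intro h
    have h1 : n ≤ n - k := h.2 (isReducible_one n)
    omega
  inv_mem := by
    intro σ h
    exact ⟨h.1.inv, fun l hl => h.2 (by simpa using IsReducible.inv hl)⟩

/-- The adjacency matrix of the Schreier graph `Sch(S_n, [n], S)`, the directed multigraph on `[n]`
with one arc from `i` to `j` for each `σ ∈ S` satisfying `σ i = j`. -/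
noncomputable def schreierMatrix {n : ℕ} (S : ConnectionSet (Equiv.Perm (Fin n))) :
    Matrix (Fin n) (Fin n) ℝ :=
  fun i j => ({σ ∈ S.carrier | σ i = j}.ncard : ℝ)

/-- `μ` is the second-largest eigenvalue (counted with multiplicity, that is, the second entry of
the list of eigenvalues in non-increasing order) of the real symmetric matrix `A`. -/
def IsSecondLargestEigenvalue {V : Type*} [Fintype V] [DecidableEq V] (A : Matrix V V ℝ)
    (μ : ℝ) : Prop :=
  ∃ (hA : A.IsHermitian) (hV : 1 < Fintype.card V), hA.eigenvalues₀ ⟨1, hV⟩ = μ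

open Classical in
/-- `μ` is the second-largest eigenvalue of the adjacency matrix of `Γ`. -/
def SimpleGraph.IsSecondLargestEigenvalue {V : Type*} [Fintype V] (Γ : SimpleGraph V)
    (μ : ℝ) : Prop :=
  _root_.IsSecondLargestEigenvalue (Γ.adjMatrix ℝ) μ

/-- The Aldous property of `Cay(S_n, S)`: the set `S` generates `S_n`, and the second-largest
eigenvalue of `Cay(S_n, S)` equals that of the Schreier graph `Sch(S_n, [n], S)`. -/
def HasAldousProperty {n : ℕ} (S : ConnectionSet (Equiv.Perm (Fin n))) : Prop :=
  Subgroup.closure S.carrier = ⊤ ∧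
    ∃ μ : ℝ, (cayleyGraph S).IsSecondLargestEigenvalue μ ∧
      IsSecondLargestEigenvalue (schreierMatrix S) μ

/-- The family `cell` of vertex sets is an equitable partition of `Γ` with quotient matrix `Q`:
each vertex in `cell i` has exactly `Q i j` neighbours in `cell j`. -/
def IsQuotientMatrix {V ι : Type*} (Γ : SimpleGraph V) (cell : ι → Set V)
    (Q : Matrix ι ι ℝ) : Prop :=
  (∀ i, (cell i).Nonempty) ∧ Pairwise (fun i j => Disjoint (cell i) (cell j)) ∧
    (⋃ i, cell i) = Set.univ ∧
    ∀ i j, ∀ v ∈ cell i, ({w ∈ cell j | Γ.Adj v w}.ncard : ℝ) = Q i j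

open scoped Pointwise in
/-- The left coset `(k i) Stab(k)` of the stabiliser of the point `k`. -/
def stabCoset {n : ℕ} (k i : Fin n) : Set (Equiv.Perm (Fin n)) :=
  Equiv.swap k i • (MulAction.stabilizer (Equiv.Perm (Fin n)) k : Set (Equiv.Perm (Fin n)))

/-! A permutation g gives the flag whose i-th member is the preimage of the initial segment ending
at i. The flags of g and h agree at i exactly when h g⁻¹ preserves that segment, i.e. when i is a
cut of h g⁻¹. The blocks of the finest invariant interval partition of σ correspond to its cuts, so
R_n(2) consists of the permutations with exactly two non-cuts, and FJ(n,2) is the Cayley graph.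

For the spectrum, pass to Laplacians. Let γ_n be the gap of the Schreier graph on [n]. An
eigenfunction v on [n] lifts to g ↦ v(g o), so the gap of the Cayley graph is at most γ_n.
Conversely, take an eigenfunction E on S_n for its gap. If some sum of E over {g | g a = b} is
nonzero, then for that a these sums, as a function of b, form a sum-zero eigenvector on [n], and the
gap is at least γ_n. Otherwise E has sum zero on every orbit of the copy of S_{n-1} fixing the last
point. The gap of S_{n-1} then bounds the energy of E from below, because the embedded connection
set lies in R_n(2). By induction it is enough that γ_n ≤ γ_{n-1}.

The induction starts at n = 4. There γ_4 = 4 = 2 + 2, where 2 is the gap of S_3 and the copies of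
S_3 fixing the first and the last point contribute disjoint sets of generators. An explicit vector
gives γ_5 ≤ 4. For larger n, `spectralGap_succ_le` uses that the Dirichlet form on [n] is a weighted
sum of squares of first and second-neighbour differences (`actionEnergy_twoNonCuts`). The test
functions repeat one entry of an eigenvector for γ_n, and the Rayleigh inequalities are averaged
over the repeated entry. The average suffices because, when γ_n ≤ 4, consecutive increments of the
eigenvector are positively correlated (`increments_correlation`) and its end increments are small
(`extreme_increments_le`). -/

/-! ### Variational description of the second-largest eigenvalue. -/

open Matrix in
/-- `μ` is the largest eigenvalue of the symmetric matrix `A` on the orthogonal complement of the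
all-ones vector, which is itself an eigenvector for an eigenvalue at least `μ`. -/
structure IsTopNontrivialEigenvalue {V : Type*} [Fintype V] (A : Matrix V V ℝ) (μ : ℝ) :
    Prop where
  symm : A.IsSymm
  const : ∃ d, μ ≤ d ∧ A *ᵥ (fun _ => 1) = fun _ => d
  eigen : ∃ v : V → ℝ, v ≠ 0 ∧ ∑ x, v x = 0 ∧ A *ᵥ v = μ • v
  bound : ∀ w : V → ℝ, ∑ x, w x = 0 → w ⬝ᵥ A *ᵥ w ≤ μ * (w ⬝ᵥ w)

namespace IsTopNontrivialEigenvalue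

open Matrix

theorem submatrix {V W : Type*} [Fintype V] [Fintype W] {A : Matrix V V ℝ} {μ : ℝ}
    (h : IsTopNontrivialEigenvalue A μ) (e : W ≃ V) :
    IsTopNontrivialEigenvalue (A.submatrix e e) μ := by
  have key : ∀ w : W → ℝ, A.submatrix e e *ᵥ w = (A *ᵥ (w ∘ e.symm)) ∘ e := fun w =>
    Matrix.submatrix_mulVec_equiv A w e e
  refine ⟨?_, ?_, ?_, ?_⟩
  · have := h.symm
    exact this.submatrix e
  · obtain ⟨d, hd, h1⟩ := h.const
    refine ⟨d, hd, ?_⟩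
    rw [key]
    funext x
    exact congrFun h1 (e x)
  · obtain ⟨v, hv, h0, h1⟩ := h.eigen
    refine ⟨v ∘ e, ?_, ?_, ?_⟩
    · intro h2
      apply hv
      funext x
      simpa using congrFun h2 (e.symm x)
    · rw [← h0]
      exact Equiv.sum_comp e v
    · rw [key]
      have : (v ∘ e) ∘ e.symm = v := by funext x; simp
      rw [this, h1]
      rfl
  · intro w hw
    rw [key]
    have h1 := h.bound (w ∘ e.symm) (by rw [← hw]; exact Equiv.sum_comp e.symm w)
    have h2 : ∀ u : V → ℝ, w ⬝ᵥ (u ∘ e) = (w ∘ e.symm) ⬝ᵥ u := by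
      intro u
      simp only [dotProduct]
      rw [← Equiv.sum_comp e]
      simp
    rw [h2]
    have h3 : w ⬝ᵥ w = (w ∘ e.symm) ⬝ᵥ (w ∘ e.symm) := by
      rw [← h2]; congr 1; funext x; simp
    rw [h3]
    exact h1

/-- Courant–Fischer in both directions: any plane contains a nonzero vector orthogonal to a
prescribed one, and the quadratic form is compared on that vector. The condition `μ ≤ d` places the
all-ones vector at or above `μ` in the list, and `μ = d` is allowed. -/
theorem isSecondLargestEigenvalue {V : Type*} [Fintype V] [DecidableEq V] {A : Matrix V V ℝ}
    {μ : ℝ} (h : IsTopNontrivialEigenvalue A μ) : IsSecondLargestEigenvalue A μ := by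
  have hA : A.IsHermitian := by
    have := h.symm
    rw [Matrix.IsHermitian, Matrix.conjTranspose_eq_transpose_of_trivial]
    exact this
  obtain ⟨d, hd, h1⟩ := h.const
  obtain ⟨v, hv, hv0, hvμ⟩ := h.eigen
  obtain ⟨x₀, hx₀⟩ : ∃ x, v x ≠ 0 := Function.ne_iff.mp hv
  have hV : 1 < Fintype.card V := by
    rw [Fintype.one_lt_card_iff_nontrivial]
    by_contra hc
    rw [not_nontrivial_iff_subsingleton] at hc
    have : Unique V := ⟨⟨x₀⟩, fun a => Subsingleton.elim _ _⟩
    rw [Fintype.sum_eq_single x₀ (fun x hx => (hx (Subsingleton.elim _ _)).elim)] at hv0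
    exact hx₀ hv0
  refine ⟨hA, hV, ?_⟩
  set E : Fin (Fintype.card V) ≃ V := Fintype.equivOfCardEq (Fintype.card_fin _) with hE
  set l : V → ℝ := hA.eigenvalues with hl
  have hl0 : ∀ i, l (E i) = hA.eigenvalues₀ i := by
    intro i
    simp [hl, Matrix.IsHermitian.eigenvalues, hE]
  set i0 : V := E ⟨0, by omega⟩ with hi0
  set i1 : V := E ⟨1, hV⟩ with hi1
  have h01 : i0 ≠ i1 := by simp [hi0, hi1]
  have hl01 : l i1 ≤ l i0 := by
    rw [hi0, hi1, hl0, hl0]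
    exact hA.eigenvalues₀_antitone (by simp [Fin.le_def])
  have hlj : ∀ j, j ≠ i0 → l j ≤ l i1 := by
    intro j hj
    obtain ⟨k, rfl⟩ := E.surjective j
    rw [hi1, hl0, hl0]
    apply hA.eigenvalues₀_antitone
    rw [Fin.le_def]
    have : k ≠ ⟨0, by omega⟩ := fun hk => hj (by rw [hk])
    have : k.val ≠ 0 := fun hk => this (Fin.ext hk)
    show 1 ≤ k.val
    omega
  set b : V → V → ℝ := fun i => (hA.eigenvectorBasis i).ofLp with hb
  have hinner : ∀ x y : V → ℝ, inner ℝ (WithLp.toLp 2 x) (WithLp.toLp 2 y) = x ⬝ᵥ y := by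
    intro x y
    rw [EuclideanSpace.inner_toLp_toLp, dotProduct_comm]
    simp
  have hAb : ∀ i, A *ᵥ b i = l i • b i := fun i => hA.mulVec_eigenvectorBasis i
  have hbb : ∀ i j, b i ⬝ᵥ b j = if i = j then 1 else 0 := by
    intro i j
    rw [← hinner]
    exact orthonormal_iff_ite.mp hA.eigenvectorBasis.orthonormal i j
  have hexp : ∀ x y : V → ℝ, x ⬝ᵥ y = ∑ i, (x ⬝ᵥ b i) * (b i ⬝ᵥ y) := by
    intro x y
    rw [← hinner, ← hA.eigenvectorBasis.sum_inner_mul_inner]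
    refine Finset.sum_congr rfl fun i _ => ?_
    rw [← hinner, ← hinner]
  have hsymm : ∀ x y : V → ℝ, x ⬝ᵥ A *ᵥ y = (A *ᵥ x) ⬝ᵥ y := by
    intro x y
    rw [Matrix.dotProduct_mulVec, ← Matrix.mulVec_transpose, h.symm.eq]
  have hq : ∀ w : V → ℝ, w ⬝ᵥ A *ᵥ w = ∑ i, l i * (b i ⬝ᵥ w) ^ 2 := by
    intro w
    rw [hexp]
    refine Finset.sum_congr rfl fun i _ => ?_
    rw [hsymm, hAb, smul_dotProduct, dotProduct_comm w, smul_eq_mul]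
    ring
  have hn : ∀ w : V → ℝ, w ⬝ᵥ w = ∑ i, (b i ⬝ᵥ w) ^ 2 := by
    intro w
    rw [hexp]
    refine Finset.sum_congr rfl fun i _ => ?_
    rw [dotProduct_comm w]
    ring
  have hpos : ∀ w : V → ℝ, w ≠ 0 → 0 < w ⬝ᵥ w := by
    intro w hw
    have : 0 ≤ w ⬝ᵥ w := Finset.sum_nonneg fun i _ => mul_self_nonneg _
    rcases this.lt_or_eq with h2 | h2
    · exact h2
    · exact (hw (dotProduct_self_eq_zero.mp h2.symm)).elim
  rw [← hl0]
  apply le_antisymm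
  · by_contra! hlt
    -- A sum-zero vector in the span of the top two eigenvectors would have Rayleigh quotient above
    -- `μ`.
    have main : ∀ α β : ℝ, (α ≠ 0 ∨ β ≠ 0) → ∑ x, (α • b i0 + β • b i1) x = 0 → False := by
      intro α β hαβ hsum
      have hbd := h.bound _ hsum
      have e1 : (α • b i0 + β • b i1) ⬝ᵥ A *ᵥ (α • b i0 + β • b i1)
          = α ^ 2 * l i0 + β ^ 2 * l i1 := by
        simp only [mulVec_add, mulVec_smul, hAb, add_dotProduct, dotProduct_add, smul_dotProduct,
          dotProduct_smul, hbb, smul_eq_mul, h01, h01.symm, if_true, if_false]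
        ring
      have e2 : (α • b i0 + β • b i1) ⬝ᵥ (α • b i0 + β • b i1) = α ^ 2 + β ^ 2 := by
        simp only [add_dotProduct, dotProduct_add, smul_dotProduct,
          dotProduct_smul, hbb, smul_eq_mul, h01, h01.symm, if_true, if_false]
        ring
      rw [e1, e2] at hbd
      have e3 : 0 < α ^ 2 + β ^ 2 := by
        rcases hαβ with h | h
        · positivity
        · positivity
      nlinarith [sq_nonneg α, mul_le_mul_of_nonneg_left hl01 (sq_nonneg α)]
    by_cases hc : ∑ x, b i1 x = 0
    · apply main 0 1 (by simp)
      simpa using hc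
    · apply main (∑ x, b i1 x) (-∑ x, b i0 x) (Or.inl hc)
      simp only [Pi.add_apply, Pi.smul_apply, smul_eq_mul, Finset.sum_add_distrib,
        ← Finset.mul_sum]
      ring
  · by_contra! hlt
    set o : V → ℝ := fun _ => 1 with ho
    have hoo : 0 < o ⬝ᵥ o := hpos _ (fun h => by simpa [ho] using congrFun h x₀)
    have hAo : A *ᵥ o = d • o := by
      rw [h1]; funext x; simp [ho]
    have hov : o ⬝ᵥ v = 0 := by simpa [ho, dotProduct] using hv0
    have hvo : v ⬝ᵥ o = 0 := by rw [dotProduct_comm, hov]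
    -- On the span of the all-ones vector and `v` the Rayleigh quotient is at least `μ`;
    -- orthogonally to the top eigenvector it is at most the second eigenvalue.
    have main : ∀ α β : ℝ, (α ≠ 0 ∨ β ≠ 0) → b i0 ⬝ᵥ (α • o + β • v) = 0 → False := by
      intro α β hαβ hsum
      have e1 : (α • o + β • v) ⬝ᵥ A *ᵥ (α • o + β • v)
          = α ^ 2 * d * (o ⬝ᵥ o) + β ^ 2 * μ * (v ⬝ᵥ v) := by
        simp only [mulVec_add, mulVec_smul, hAo, hvμ, add_dotProduct, dotProduct_add,
          smul_dotProduct, dotProduct_smul, smul_eq_mul, hov, hvo]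
        ring
      have e2 : (α • o + β • v) ⬝ᵥ (α • o + β • v)
          = α ^ 2 * (o ⬝ᵥ o) + β ^ 2 * (v ⬝ᵥ v) := by
        simp only [add_dotProduct, dotProduct_add,
          smul_dotProduct, dotProduct_smul, smul_eq_mul, hov, hvo]
        ring
      have hle : (α • o + β • v) ⬝ᵥ A *ᵥ (α • o + β • v)
          ≤ l i1 * ((α • o + β • v) ⬝ᵥ (α • o + β • v)) := by
        rw [hq, hn, Finset.mul_sum]
        refine Finset.sum_le_sum fun j _ => ?_
        by_cases hj : j = i0
        · rw [hj, hsum]; simp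
        · exact mul_le_mul_of_nonneg_right (hlj j hj) (sq_nonneg _)
      rw [e1, e2] at hle
      have hvv := hpos v hv
      have e3 : 0 < α ^ 2 * (o ⬝ᵥ o) + β ^ 2 * (v ⬝ᵥ v) := by
        rcases hαβ with h | h
        · positivity
        · positivity
      have e4 : α ^ 2 * μ * (o ⬝ᵥ o) ≤ α ^ 2 * d * (o ⬝ᵥ o) := by gcongr
      nlinarith
    by_cases hc : b i0 ⬝ᵥ v = 0
    · apply main 0 1 (by simp)
      simpa using hc
    · apply main (b i0 ⬝ᵥ v) (-(b i0 ⬝ᵥ o)) (Or.inl hc)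
      simp only [dotProduct_add, dotProduct_smul, smul_eq_mul]
      ring

/-- A symmetric matrix with constant row sums `d` and quadratic form at most `d` has a largest
eigenvalue on the orthogonal complement of the all-ones vector. -/
theorem exists_of_symm {V : Type*} [Fintype V] [Nontrivial V] {A : Matrix V V ℝ}
    (hA : A.IsSymm) {d : ℝ} (hd : A *ᵥ (fun _ => 1) = fun _ => d)
    (hle : ∀ w : V → ℝ, w ⬝ᵥ A *ᵥ w ≤ d * (w ⬝ᵥ w)) :
    ∃ μ, IsTopNontrivialEigenvalue A μ := by
  classical
  have hH : A.IsHermitian := by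
    rw [Matrix.IsHermitian, Matrix.conjTranspose_eq_transpose_of_trivial]
    exact hA
  set o : EuclideanSpace ℝ V := WithLp.toLp 2 (fun _ => 1) with ho
  set T := Matrix.toEuclideanLin A with hT
  have hTs : T.IsSymmetric := Matrix.isSymmetric_toEuclideanLin_iff.mpr hH
  have hinner : ∀ x y : V → ℝ, inner ℝ (WithLp.toLp 2 x) (WithLp.toLp 2 y) = x ⬝ᵥ y := by
    intro x y
    rw [EuclideanSpace.inner_toLp_toLp, dotProduct_comm]
    simp
  have hTo : T o = d • o := by
    rw [hT, ho, Matrix.toLpLin_toLp, Matrix.toLin'_apply, hd]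
    ext x
    simp
  -- `T` preserves the complement of its eigenvector `o`, and `μ` is the maximal Rayleigh quotient
  -- of the restriction.
  set K : Submodule ℝ (EuclideanSpace ℝ V) := (Submodule.span ℝ {o})ᗮ with hK
  have hmem : ∀ w : EuclideanSpace ℝ V, w ∈ K ↔ ∑ x, w x = 0 := by
    intro w
    rw [hK, Submodule.mem_orthogonal_singleton_iff_inner_right]
    have := hinner (fun _ => 1) w.ofLp
    rw [← ho] at this
    rw [show w = WithLp.toLp 2 w.ofLp from rfl, this]
    simp [dotProduct]
  have hinv : ∀ w ∈ K, T w ∈ K := by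
    intro w hw
    rw [hK, Submodule.mem_orthogonal_singleton_iff_inner_right] at hw ⊢
    rw [← hTs, hTo, inner_smul_left, hw, mul_zero]
  have hnt : Nontrivial K := by
    obtain ⟨x, y, hxy⟩ := exists_pair_ne V
    refine ⟨⟨⟨WithLp.toLp 2 (Pi.single x 1 - Pi.single y 1), ?_⟩, 0, ?_⟩⟩
    · rw [hmem]
      simp [Finset.sum_sub_distrib]
    · intro h0
      have := congrArg (fun w : K => w.1 x) h0
      simp [hxy] at this
  have hTK := hTs.restrict_invariant hinv
  have hq : ∀ w : EuclideanSpace ℝ V, inner ℝ (T w) w = w.ofLp ⬝ᵥ A *ᵥ w.ofLp := by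
    intro w
    have : T w = WithLp.toLp 2 (A *ᵥ w.ofLp) := rfl
    rw [this, show w = WithLp.toLp 2 w.ofLp from rfl, hinner, dotProduct_comm]
  have hn : ∀ w : EuclideanSpace ℝ V, ‖w‖ ^ 2 = w.ofLp ⬝ᵥ w.ofLp := by
    intro w
    rw [← real_inner_self_eq_norm_sq, ← hinner]
  have hev := hTK.hasEigenvalue_iSup_of_finiteDimensional
  set μ : ℝ := ⨆ x : { x : K // x ≠ 0 }, RCLike.re
    (inner ℝ ((T.restrict hinv) x.1) x.1) / ‖(x : K)‖ ^ 2 with hμ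
  obtain ⟨v, hv⟩ := hev.exists_hasEigenvector
  have hquot : ∀ w : K, w ≠ 0 → RCLike.re (inner ℝ ((T.restrict hinv) w) w) / ‖w‖ ^ 2 ≤ d := by
    intro w hw
    have h1 : 0 < ‖w‖ ^ 2 := by positivity
    rw [div_le_iff₀ h1]
    have h2 := hle w.1.ofLp
    rw [← hq, ← hn] at h2
    exact h2
  have hv2 : T v.1 = μ • v.1 := by
    have := congrArg Subtype.val hv.apply_eq_smul
    simpa using this
  have hbound : ∀ w : K, inner ℝ (T w.1) w.1 ≤ μ * ‖w.1‖ ^ 2 := by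
    intro w
    by_cases hw : w = 0
    · simp [hw]
    · have h1 : 0 < ‖w.1‖ ^ 2 := by
        have : w.1 ≠ 0 := fun h => hw (Subtype.ext h)
        positivity
      rw [← div_le_iff₀ h1]
      exact le_ciSup (f := fun x : { x : K // x ≠ 0 } => RCLike.re
        (inner ℝ ((T.restrict hinv) x.1) x.1) / ‖(x : K)‖ ^ 2)
        ⟨d, by rintro _ ⟨x, rfl⟩; exact hquot x.1 x.2⟩ ⟨w, hw⟩
  refine ⟨μ, hA, ⟨d, ?_, hd⟩, ⟨v.1.ofLp, ?_, (hmem _).mp v.2, ?_⟩, ?_⟩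
  · have : Nonempty { x : K // x ≠ 0 } := ⟨⟨v, hv.2⟩⟩
    exact ciSup_le fun x => hquot x.1 x.2
  · intro h0
    apply hv.2
    apply Subtype.ext
    ext x
    exact congrFun h0 x
  · exact congrArg WithLp.ofLp hv2
  · intro w hw
    have := hbound ⟨WithLp.toLp 2 w, (hmem _).mpr hw⟩
    rw [hq, hn] at this
    exact this

end IsTopNontrivialEigenvalue

/-! ### Dirichlet forms and spectral gaps of Schreier graphs. -/

/-- The adjacency matrix of the Schreier graph of a finite set `T` of group elements acting
on `X`. -/
noncomputable def actionMatrix {G : Type*} (X : Type*) [Group G] [MulAction G X] [DecidableEq X]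
    (T : Finset G) : Matrix X X ℝ :=
  fun x y => (({σ ∈ T | σ • x = y}).card : ℝ)

/-- The Dirichlet form of the Schreier graph of `T` acting on `X`. -/
noncomputable def actionEnergy {G X : Type*} [Group G] [MulAction G X] [Fintype X]
    (T : Finset G) (f : X → ℝ) : ℝ :=
  (1 / 2) * ∑ σ ∈ T, ∑ x, (f (σ • x) - f x) ^ 2

/-- `γ` is the smallest eigenvalue of the Laplacian of the Schreier graph of `T` acting on `X`,
restricted to the functions of sum zero. -/
structure IsSpectralGap {G : Type*} (X : Type*) [Group G] [MulAction G X] [Fintype X]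
    (T : Finset G) (γ : ℝ) : Prop where
  eigen : ∃ v : X → ℝ, v ≠ 0 ∧ ∑ x, v x = 0 ∧
    ∀ x, ∑ σ ∈ T, (v x - v (σ • x)) = γ * v x
  bound : ∀ w : X → ℝ, ∑ x, w x = 0 → γ * ∑ x, w x ^ 2 ≤ actionEnergy T w

section Action

open Matrix

variable {G X : Type*} [Group G] [MulAction G X] [Fintype X]

theorem sum_smul_action (σ : G) (f : X → ℝ) : ∑ x, f (σ • x) = ∑ x, f x :=
  Equiv.sum_comp (MulAction.toPerm σ) f

theorem actionEnergy_nonneg (T : Finset G) (f : X → ℝ) : 0 ≤ actionEnergy T f := by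
  unfold actionEnergy
  positivity

theorem actionEnergy_eq_sum_mul (T : Finset G) (f : X → ℝ) :
    actionEnergy T f = ∑ x, f x * ∑ σ ∈ T, (f x - f (σ • x)) := by
  have h : ∀ σ : G, ∑ x, (f (σ • x) - f x) ^ 2 = 2 * ∑ x, f x * (f x - f (σ • x)) := by
    intro σ
    have h1 := sum_smul_action σ (fun x => f x ^ 2)
    have h2 : ∀ x, (f (σ • x) - f x) ^ 2
        = 2 * (f x * (f x - f (σ • x))) + (f (σ • x) ^ 2 - f x ^ 2) := fun x => by ring
    simp only [h2, Finset.sum_add_distrib, Finset.sum_sub_distrib, h1, sub_self, add_zero,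
      ← Finset.mul_sum]
  unfold actionEnergy
  simp only [h, ← Finset.mul_sum]
  rw [Finset.sum_comm]
  simp only [Finset.mul_sum]
  refine Finset.sum_congr rfl fun x _ => Finset.sum_congr rfl fun σ _ => ?_
  ring

/-- The polarisation of the Dirichlet form. -/
theorem sum_mul_laplacian {T : Finset G} (hT : ∀ σ ∈ T, σ⁻¹ ∈ T) (f h : X → ℝ) :
    ∑ x, h x * ∑ σ ∈ T, (f x - f (σ • x))
      = (1 / 2) * ∑ σ ∈ T, ∑ x, (f (σ • x) - f x) * (h (σ • x) - h x) := by
  have e1 : ∀ σ : G, ∑ x, f (σ • x) * h (σ • x) = ∑ x, f x * h x := fun σ =>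
    sum_smul_action σ (fun x => f x * h x)
  have e2 : ∑ σ ∈ T, ∑ x, f x * h (σ • x) = ∑ σ ∈ T, ∑ x, f (σ • x) * h x := by
    refine Finset.sum_bij' (fun σ _ => σ⁻¹) (fun σ _ => σ⁻¹) hT hT (by simp) (by simp) ?_
    intro σ _
    rw [← sum_smul_action σ (fun x => f (σ⁻¹ • x) * h x)]
    simp
  have e3 : ∀ σ : G, ∑ x, (f (σ • x) - f x) * (h (σ • x) - h x) = 2 * ∑ x, f x * h x
      - ∑ x, f x * h (σ • x) - ∑ x, f (σ • x) * h x := by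
    intro σ
    have : ∀ x, (f (σ • x) - f x) * (h (σ • x) - h x)
      = f (σ • x) * h (σ • x) + f x * h x - f x * h (σ • x) - f (σ • x) * h x := fun x => by ring
    simp only [this, Finset.sum_sub_distrib, Finset.sum_add_distrib, e1]
    ring
  simp only [e3, Finset.sum_sub_distrib, e2]
  simp only [Finset.mul_sum, mul_sub, Finset.sum_sub_distrib]
  rw [Finset.sum_comm, ← sub_eq_zero]
  rw [Finset.sum_comm (s := Finset.univ) (t := T) (f := fun x σ => h x * f (σ • x))]
  have c1 : ∀ x σ, h x * f (σ • x) = f (σ • x) * h x := fun x (σ : G) => mul_comm _ _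
  have c2 : ∀ x, h x * f x = f x * h x := fun x => mul_comm _ _
  simp only [c1, c2, ← Finset.mul_sum]
  ring

theorem energy_eigenvector {T : Finset G} {γ : ℝ} {v : X → ℝ}
    (hv : ∀ x, ∑ σ ∈ T, (v x - v (σ • x)) = γ * v x) :
    actionEnergy T v = γ * ∑ x, v x ^ 2 := by
  rw [actionEnergy_eq_sum_mul, Finset.mul_sum]
  refine Finset.sum_congr rfl fun x _ => ?_
  rw [hv]
  ring

theorem sum_sq_pos {v : X → ℝ} (hv : v ≠ 0) : 0 < ∑ x, v x ^ 2 := by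
  obtain ⟨x, hx⟩ := Function.ne_iff.mp hv
  exact Finset.sum_pos' (fun _ _ => sq_nonneg _) ⟨x, Finset.mem_univ _, by
    have : v x ≠ 0 := hx
    positivity⟩

theorem IsSpectralGap.le_of_eigenvector {T : Finset G} {γ γ' : ℝ} (h : IsSpectralGap X T γ)
    {v : X → ℝ} (hv : v ≠ 0) (h0 : ∑ x, v x = 0)
    (hγ : ∀ x, ∑ σ ∈ T, (v x - v (σ • x)) = γ' * v x) : γ ≤ γ' := by
  have := h.bound v h0
  rw [energy_eigenvector hγ] at this
  exact le_of_mul_le_mul_right this (sum_sq_pos hv)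

section

variable [DecidableEq X]

theorem actionMatrix_mulVec (T : Finset G) (f : X → ℝ) (x : X) :
    (actionMatrix X T *ᵥ f) x = ∑ σ ∈ T, f (σ • x) := by
  simp only [actionMatrix, mulVec, dotProduct, Finset.card_filter, Nat.cast_sum, Finset.sum_mul]
  rw [Finset.sum_comm]
  simp

omit [Fintype X] in
theorem actionMatrix_isSymm {T : Finset G} (hT : ∀ σ ∈ T, σ⁻¹ ∈ T) :
    (actionMatrix X T).IsSymm := by
  ext x y
  simp only [transpose_apply, actionMatrix, Nat.cast_inj]
  refine Finset.card_bij' (fun σ _ => σ⁻¹) (fun σ _ => σ⁻¹) ?_ ?_ (by simp) (by simp)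
  all_goals
    intro σ hσ
    rw [Finset.mem_filter] at hσ ⊢
    refine ⟨hT σ hσ.1, ?_⟩
    rw [← hσ.2, inv_smul_smul]

theorem dotProduct_actionMatrix (T : Finset G) (f : X → ℝ) :
    f ⬝ᵥ actionMatrix X T *ᵥ f = T.card * (f ⬝ᵥ f) - actionEnergy T f := by
  rw [actionEnergy_eq_sum_mul]
  simp only [dotProduct, actionMatrix_mulVec, Finset.sum_sub_distrib, Finset.sum_const, mul_sub,
    nsmul_eq_mul]
  rw [Finset.mul_sum, eq_sub_iff_add_eq]
  rw [add_sub_cancel]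
  exact Finset.sum_congr rfl fun x _ => by ring

/-- The Laplacian is `T.card` times the identity minus the adjacency matrix, so adjacency
eigenvalues and gaps determine each other through the same degree for every action of `G`. Comparing
two actions reduces to comparing gaps. -/
theorem isTopNontrivialEigenvalue_iff {T : Finset G} (hT : ∀ σ ∈ T, σ⁻¹ ∈ T) (μ : ℝ) :
    IsTopNontrivialEigenvalue (actionMatrix X T) μ ↔ IsSpectralGap X T (T.card - μ) := by
  have he : ∀ v : X → ℝ, actionMatrix X T *ᵥ v = μ • v ↔
      ∀ x, ∑ σ ∈ T, (v x - v (σ • x)) = (T.card - μ) * v x := by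
    intro v
    rw [funext_iff]
    refine forall_congr' fun x => ?_
    rw [actionMatrix_mulVec, Finset.sum_sub_distrib, Finset.sum_const, nsmul_eq_mul,
      Pi.smul_apply, smul_eq_mul]
    constructor <;> intro h <;> linarith
  have hs : ∀ w : X → ℝ, w ⬝ᵥ w = ∑ x, w x ^ 2 := fun w =>
    Finset.sum_congr rfl fun x _ => by ring
  constructor
  · intro h
    refine ⟨?_, ?_⟩
    · obtain ⟨v, h1, h2, h3⟩ := h.eigen
      exact ⟨v, h1, h2, (he v).mp h3⟩
    · intro w hw
      have := h.bound w hw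
      rw [dotProduct_actionMatrix, hs] at this
      linarith
  · intro h
    obtain ⟨v, h1, h2, h3⟩ := h.eigen
    refine ⟨actionMatrix_isSymm hT, ⟨T.card, ?_, ?_⟩, ⟨v, h1, h2, (he v).mpr h3⟩, ?_⟩
    · have e1 := energy_eigenvector h3
      have e2 := actionEnergy_nonneg T v
      rw [e1] at e2
      have := nonneg_of_mul_nonneg_left e2 (sum_sq_pos h1)
      linarith
    · funext x
      rw [actionMatrix_mulVec]
      simp
    · intro w hw
      have := h.bound w hw
      rw [dotProduct_actionMatrix, hs]
      linarith

end

theorem exists_isSpectralGap [Nontrivial X] {T : Finset G} (hT : ∀ σ ∈ T, σ⁻¹ ∈ T) :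
    ∃ γ, IsSpectralGap X T γ := by
  classical
  obtain ⟨μ, hμ⟩ := IsTopNontrivialEigenvalue.exists_of_symm (actionMatrix_isSymm (X := X) hT)
    (d := T.card) (by funext x; rw [actionMatrix_mulVec]; simp)
    (fun w => by
      rw [dotProduct_actionMatrix]
      have := actionEnergy_nonneg T w
      linarith)
  exact ⟨_, (isTopNontrivialEigenvalue_iff hT μ).mp hμ⟩

end Action

/-! ### Cuts of a permutation, and the permutations with two given non-cuts. -/

/-- The initial segments `{x | x ≤ i}` that are not preserved by `σ`. -/
def nonCuts {n : ℕ} (σ : Equiv.Perm (Fin n)) : Finset (Fin n) :=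
  {i | ¬ ∀ x ≤ i, σ x ≤ i}

section NonCuts

variable {n : ℕ}

theorem notMem_nonCuts {σ : Equiv.Perm (Fin n)} {i : Fin n} :
    i ∉ nonCuts σ ↔ ∀ x, σ x ≤ i ↔ x ≤ i := by
  simp only [nonCuts, Finset.mem_filter, Finset.mem_univ, true_and, not_not]
  refine ⟨fun h => ?_, fun h x hx => (h x).mpr hx⟩
  have h1 : (Finset.Iic i).map σ.toEmbedding = Finset.Iic i := by
    apply Finset.eq_of_subset_of_card_le
    · intro y hy
      obtain ⟨x, hx, rfl⟩ := Finset.mem_map.mp hy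
      exact Finset.mem_Iic.mpr (h x (Finset.mem_Iic.mp hx))
    · rw [Finset.card_map]
  intro x
  refine ⟨fun hx => ?_, h x⟩
  have h2 : σ x ∈ (Finset.Iic i).map σ.toEmbedding := by
    rw [h1]; exact Finset.mem_Iic.mpr hx
  obtain ⟨y, hy, hyx⟩ := Finset.mem_map.mp h2
  rw [← σ.injective hyx]
  exact Finset.mem_Iic.mp hy

theorem mem_nonCuts {σ : Equiv.Perm (Fin n)} {i : Fin n} :
    i ∈ nonCuts σ ↔ ∃ x ≤ i, i < σ x := by
  simp [nonCuts]

theorem nonCuts_inv (σ : Equiv.Perm (Fin n)) : nonCuts σ⁻¹ = nonCuts σ := by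
  ext i
  rw [← not_iff_not, notMem_nonCuts, notMem_nonCuts]
  constructor
  · intro h x
    rw [← h]
    simp
  · intro h x
    rw [← h]
    simp

theorem isReducible_sub_card_nonCuts (σ : Equiv.Perm (Fin n)) :
    IsReducible σ (n - (nonCuts σ).card) := by
  classical
  rcases Nat.eq_zero_or_pos n with rfl | hn
  · refine ⟨⊥, by simp, ?_⟩
    intro I hI
    rw [Finpartition.mem_bot_iff] at hI
    obtain ⟨a, -⟩ := hI
    exact a.elim0
  set C : Finset (Fin n) := (nonCuts σ)ᶜ with hC
  have hlast : (⟨n - 1, by omega⟩ : Fin n) ∈ C := by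
    rw [hC, Finset.mem_compl, mem_nonCuts]
    rintro ⟨x, -, hx⟩
    have := (σ x).2
    rw [Fin.lt_def] at hx
    simp at hx
    omega
  have hne : ∀ x : Fin n, (C.filter (x ≤ ·)).Nonempty := fun x =>
    ⟨_, Finset.mem_filter.mpr ⟨hlast, by rw [Fin.le_def]; have := x.2; simp; omega⟩⟩
  -- The blocks are the fibres of the map sending x to the least cut that is at least x. The last
  -- index is always a cut, so this map is defined everywhere.
  set nx : Fin n → Fin n := fun x => (C.filter (x ≤ ·)).min' (hne x) with hnx
  have nx_mem : ∀ x, nx x ∈ C ∧ x ≤ nx x := fun x =>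
    Finset.mem_filter.mp (Finset.min'_mem _ (hne x))
  have nx_le : ∀ x c, c ∈ C → x ≤ c → nx x ≤ c := fun x c hc hx =>
    Finset.min'_le _ _ (Finset.mem_filter.mpr ⟨hc, hx⟩)
  have nx_self : ∀ c ∈ C, nx c = c := fun c hc =>
    le_antisymm (nx_le c c hc le_rfl) (nx_mem c).2
  have nx_mono : ∀ x y, x ≤ y → nx x ≤ nx y := fun x y h =>
    nx_le x _ (nx_mem y).1 (h.trans (nx_mem y).2)
  have hcut : ∀ c ∈ C, ∀ x, σ x ≤ c ↔ x ≤ c := fun c hc =>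
    notMem_nonCuts.mp (Finset.mem_compl.mp hc)
  have nx_inv : ∀ x, nx (σ x) = nx x := fun x =>
    le_antisymm (nx_le _ _ (nx_mem x).1 ((hcut _ (nx_mem x).1 x).mpr (nx_mem x).2))
      (nx_le _ _ (nx_mem _).1 ((hcut _ (nx_mem _).1 x).mp (nx_mem _).2))
  set part : Fin n → Finset (Fin n) := fun c => {x | nx x = c} with hpart
  have mem_part : ∀ x c, x ∈ part c ↔ nx x = c := by simp [hpart]
  have hinj : Set.InjOn part C := by
    intro c hc d hd h
    have : c ∈ part d := by rw [← h, mem_part, nx_self c hc]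
    rw [mem_part, nx_self c hc] at this
    exact this
  refine ⟨Finpartition.ofExistsUnique (C.image part) (fun _ _ => Finset.subset_univ _) ?_ ?_,
    ?_, ?_⟩
  · intro a _
    refine ⟨part (nx a), ⟨Finset.mem_image_of_mem _ (nx_mem a).1, (mem_part _ _).mpr rfl⟩, ?_⟩
    rintro _ ⟨h1, h2⟩
    obtain ⟨c, -, rfl⟩ := Finset.mem_image.mp h1
    rw [(mem_part _ _).mp h2]
  · intro h
    obtain ⟨c, hc, h⟩ := Finset.mem_image.mp h
    have : c ∈ part c := (mem_part _ _).mpr (nx_self c hc)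
    rw [h] at this
    simp at this
  · show (C.image part).card = _
    rw [Finset.card_image_of_injOn hinj, hC, Finset.card_compl, Fintype.card_fin]
  · intro I hI
    obtain ⟨c, hc, rfl⟩ := Finset.mem_image.mp (show I ∈ C.image part from hI)
    constructor
    · refine ⟨fun x hx y hy z hz => ?_⟩
      rw [Finset.mem_coe, mem_part] at *
      exact le_antisymm (hy ▸ nx_mono z y hz.2) (hx ▸ nx_mono x z hz.1)
    · ext y
      simp only [Set.mem_image, Finset.mem_coe, mem_part]
      constructor
      · rintro ⟨x, hx, rfl⟩
        rw [nx_inv, hx]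
      · intro hy
        refine ⟨σ⁻¹ y, ?_, by simp⟩
        rw [← nx_inv]
        simpa using hy

/-- The maximum of each block is a cut: an element carried past it would lie in an interval block
containing that maximum, hence in the same block. Distinct blocks have distinct maxima. -/
theorem IsReducible.add_card_nonCuts_le {σ : Equiv.Perm (Fin n)} {l : ℕ} (h : IsReducible σ l) :
    l + (nonCuts σ).card ≤ n := by
  classical
  obtain ⟨P, hP, h⟩ := h
  have hle : P.parts.card ≤ (nonCuts σ)ᶜ.card := by
    rcases P.parts.eq_empty_or_nonempty with h0 | ⟨I₀, hI₀⟩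
    · simp [h0]
    have : Nonempty (Fin n) := ⟨(P.nonempty_of_mem_parts hI₀).choose⟩
    have hex : ∀ I ∈ P.parts, ∃ m ∈ I, ∀ x ∈ I, x ≤ m := fun I hI =>
      I.exists_max_image id (P.nonempty_of_mem_parts hI)
    choose! M hM hMle using hex
    refine Finset.card_le_card_of_injOn M (fun I hI => ?_) (fun I hI J hJ hIJ => ?_)
    · rw [Finset.mem_coe, Finset.mem_compl, mem_nonCuts]
      rintro ⟨x, hx, hlt⟩
      obtain ⟨J, hJ, hxJ⟩ := P.exists_mem (Finset.mem_univ x)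
      have hσ : σ x ∈ J := by
        rw [← Finset.mem_coe, ← (h J hJ).2]
        exact ⟨x, hxJ, rfl⟩
      have hMJ : M I ∈ J := (h J hJ).1.out hxJ hσ ⟨hx, hlt.le⟩
      have : I = J := P.eq_of_mem_parts hI hJ (hM I hI) hMJ
      subst this
      exact absurd (hMle I hI _ hσ) (not_le.mpr hlt)
    · exact P.eq_of_mem_parts hI hJ (hM I hI) (hIJ ▸ hM J hJ)
  rw [Finset.card_compl, Fintype.card_fin] at hle
  have := Finset.card_le_univ (nonCuts σ)
  rw [Fintype.card_fin] at this
  omega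

theorem isMaximallyReducible_iff {σ : Equiv.Perm (Fin n)} {m : ℕ} :
    IsMaximallyReducible σ m ↔ m + (nonCuts σ).card = n := by
  have hle := Finset.card_le_univ (nonCuts σ)
  rw [Fintype.card_fin] at hle
  have h0 : IsMaximallyReducible σ (n - (nonCuts σ).card) := by
    refine ⟨isReducible_sub_card_nonCuts σ, fun l hl => ?_⟩
    have := IsReducible.add_card_nonCuts_le hl
    omega
  constructor
  · intro h
    have := IsGreatest.unique h h0
    omega
  · intro h
    have : m = n - (nonCuts σ).card := by omega
    rwa [this]

theorem apply_eq_self_of_notMem_nonCuts {σ : Equiv.Perm (Fin n)} {i : Fin n}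
    (h : i ∉ nonCuts σ) (h' : ∀ j : Fin n, (j : ℕ) + 1 = i → j ∉ nonCuts σ) : σ i = i := by
  have h1 : σ i ≤ i := (notMem_nonCuts.mp h i).mpr le_rfl
  rcases h1.lt_or_eq with h2 | h2
  · rw [Fin.lt_def] at h2
    have h3 := (notMem_nonCuts.mp (h' ⟨i - 1, by omega⟩ (by simp; omega)) i).mp
      (by rw [Fin.le_def]; simp; omega)
    rw [Fin.le_def] at h3
    simp at h3
    omega
  · exact h2

theorem nonCuts_swap_mul_swap {a b c : Fin n} (hab : (b : ℕ) = a + 1) (hbc : (c : ℕ) = b + 1) :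
    nonCuts (Equiv.swap a b * Equiv.swap b c) = {a, b} := by
  ext i
  rw [mem_nonCuts, Finset.mem_insert, Finset.mem_singleton]
  simp only [Equiv.Perm.mul_apply, Equiv.swap_apply_def]
  constructor
  · rintro ⟨x, hx, h⟩
    simp only [Fin.ext_iff, Fin.le_def, Fin.lt_def] at *
    split_ifs at h <;> omega
  · intro h
    refine ⟨i, le_rfl, ?_⟩
    simp only [Fin.ext_iff, Fin.lt_def] at *
    split_ifs <;> omega

theorem nonCuts_swap {a b c : Fin n} (hab : (b : ℕ) = a + 1) (hbc : (c : ℕ) = b + 1) :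
    nonCuts (Equiv.swap a c) = {a, b} := by
  ext i
  rw [mem_nonCuts, Finset.mem_insert, Finset.mem_singleton]
  simp only [Equiv.swap_apply_def]
  constructor
  · rintro ⟨x, hx, h⟩
    simp only [Fin.ext_iff, Fin.le_def, Fin.lt_def] at *
    split_ifs at h <;> omega
  · rintro h
    refine ⟨a, ?_, ?_⟩
    · simp only [Fin.ext_iff, Fin.le_def] at *
      omega
    · rw [if_pos rfl]
      simp only [Fin.ext_iff, Fin.lt_def] at *
      omega

theorem nonCuts_swap_mul_swap_of_lt {a a' b b' : Fin n} (ha : (a' : ℕ) = a + 1)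
    (hb : (b' : ℕ) = b + 1) (hab : a' < b) :
    nonCuts (Equiv.swap a a' * Equiv.swap b b') = {a, b} := by
  ext i
  rw [mem_nonCuts, Finset.mem_insert, Finset.mem_singleton]
  simp only [Equiv.Perm.mul_apply, Equiv.swap_apply_def]
  constructor
  · rintro ⟨x, hx, h⟩
    simp only [Fin.ext_iff, Fin.le_def, Fin.lt_def] at *
    split_ifs at h <;> omega
  · rintro h
    refine ⟨i, le_rfl, ?_⟩
    simp only [Fin.ext_iff, Fin.lt_def] at *
    split_ifs <;> omega

/-- Such a permutation is supported on {a, b, c}. It cannot fix a or c, since then a or b would be a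
cut; this leaves three of the six permutations. -/
theorem filter_nonCuts_eq_of_adjacent {a b c : Fin n} (hab : (b : ℕ) = a + 1)
    (hbc : (c : ℕ) = b + 1) :
    ({σ | nonCuts σ = {a, b}} : Finset (Equiv.Perm (Fin n))) =
      {Equiv.swap a c, Equiv.swap a b * Equiv.swap b c, Equiv.swap b c * Equiv.swap a b} := by
  have nab : a ≠ b := by rw [Ne, Fin.ext_iff]; omega
  have nac : a ≠ c := by rw [Ne, Fin.ext_iff]; omega
  have nbc : b ≠ c := by rw [Ne, Fin.ext_iff]; omega
  ext σ
  simp only [Finset.mem_filter, Finset.mem_univ, true_and, Finset.mem_insert,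
    Finset.mem_singleton]
  constructor
  · intro h
    have hfix : ∀ x, x ≠ a → x ≠ b → x ≠ c → σ x = x := by
      intro x ha hb hc
      simp only [Ne, Fin.ext_iff] at ha hb hc
      apply apply_eq_self_of_notMem_nonCuts
      · simp [h, Fin.ext_iff, ha, hb]
      · intro j hj
        simp only [h, Finset.mem_insert, Finset.mem_singleton, Fin.ext_iff]
        omega
    have hmem : ∀ x, x = a ∨ x = b ∨ x = c → σ x = a ∨ σ x = b ∨ σ x = c := by
      intro x hx
      by_contra hc
      push Not at hc
      have := σ.injective (hfix (σ x) hc.1 hc.2.1 hc.2.2)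
      rw [this] at hc
      tauto
    have ha : σ a ≠ a := by
      intro ha
      have : a ∈ nonCuts σ := by simp [h]
      obtain ⟨x, hx, hlt⟩ := mem_nonCuts.mp this
      rcases eq_or_ne x a with rfl | hxa
      · rw [ha] at hlt; exact lt_irrefl _ hlt
      · rw [hfix x hxa] at hlt
        · exact absurd hlt (not_lt.mpr hx)
        · rintro rfl; rw [Fin.le_def] at hx; omega
        · rintro rfl; rw [Fin.le_def] at hx; omega
    have hc : σ c ≠ c := by
      intro hc
      have : b ∈ nonCuts σ := by simp [h]
      obtain ⟨x, hx, hlt⟩ := mem_nonCuts.mp this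
      have hxc : x ≠ c := by rintro rfl; rw [Fin.le_def] at hx; omega
      have hσx : σ x ≠ c := fun h' => hxc (σ.injective (h'.trans hc.symm))
      by_cases hxa : x = a ∨ x = b
      · rcases hmem x (by tauto) with h1 | h1 | h1
        · rw [h1, Fin.lt_def] at hlt; omega
        · rw [h1, Fin.lt_def] at hlt; omega
        · exact hσx h1
      · push Not at hxa
        rw [hfix x hxa.1 hxa.2 hxc] at hlt
        exact absurd hlt (not_lt.mpr hx)
    have iab : σ a ≠ σ b := σ.injective.ne nab
    have iac : σ a ≠ σ c := σ.injective.ne nac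
    have ibc : σ b ≠ σ c := σ.injective.ne nbc
    have ext : ∀ τ : Equiv.Perm (Fin n), σ a = τ a → σ b = τ b → σ c = τ c →
        (∀ x, x ≠ a → x ≠ b → x ≠ c → τ x = x) → σ = τ := by
      intro τ h1 h2 h3 h4
      ext1 x
      by_cases xa : x = a
      · rw [xa, h1]
      by_cases xb : x = b
      · rw [xb, h2]
      by_cases xc : x = c
      · rw [xc, h3]
      rw [hfix x xa xb xc, h4 x xa xb xc]
    rcases hmem a (by simp) with h1 | h1 | h1
    · exact absurd h1 ha
    · right; left
      have h2 : σ c = a := by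
        rcases hmem c (by simp) with h2 | h2 | h2
        · exact h2
        · exact absurd (h1.trans h2.symm) iac
        · exact absurd h2 hc
      have h3 : σ b = c := by
        rcases hmem b (by simp) with h3 | h3 | h3
        · exact absurd (h3.trans h2.symm) ibc
        · exact absurd (h1.trans h3.symm) iab
        · exact h3
      apply ext
      · rw [h1]; simp [Equiv.swap_apply_def, nab, nac]
      · rw [h3]; simp [Equiv.swap_apply_def, nac.symm, nbc.symm]
      · rw [h2]; simp
      · intro x xa xb xc
        simp [Equiv.swap_apply_def, xa, xb, xc]
    · rcases hmem c (by simp) with h2 | h2 | h2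
      · left
        have h3 : σ b = b := by
          rcases hmem b (by simp) with h3 | h3 | h3
          · exact absurd (h3.trans h2.symm) ibc
          · exact h3
          · exact absurd (h1.trans h3.symm) iab
        apply ext
        · rw [h1]; simp
        · rw [h3]; simp [Equiv.swap_apply_def, nab.symm, nbc]
        · rw [h2]; simp
        · intro x xa xb xc
          simp [Equiv.swap_apply_def, xa, xc]
      · right; right
        have h3 : σ b = a := by
          rcases hmem b (by simp) with h3 | h3 | h3
          · exact h3
          · exact absurd (h3.trans h2.symm) ibc
          · exact absurd (h1.trans h3.symm) iab
        apply ext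
        · rw [h1]; simp
        · rw [h3]; simp [Equiv.swap_apply_def, nab, nac]
        · rw [h2]; simp [Equiv.swap_apply_def, nac.symm, nbc.symm]
        · intro x xa xb xc
          simp [Equiv.swap_apply_def, xa, xb, xc]
      · exact absurd h2 hc
  · rintro (rfl | rfl | rfl)
    · exact nonCuts_swap hab hbc
    · exact nonCuts_swap_mul_swap hab hbc
    · rw [← nonCuts_swap_mul_swap hab hbc, ← nonCuts_inv]
      simp

/-- The pairs {a, a'} and {b, b'} are separate invariant blocks, and σ must exchange the two points
of each, since otherwise a or b would be a cut. -/
theorem filter_nonCuts_eq_of_lt {a a' b b' : Fin n} (ha : (a' : ℕ) = a + 1)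
    (hb : (b' : ℕ) = b + 1) (hab : a' < b) :
    ({σ | nonCuts σ = {a, b}} : Finset (Equiv.Perm (Fin n))) =
      {Equiv.swap a a' * Equiv.swap b b'} := by
  rw [Fin.lt_def] at hab
  ext σ
  simp only [Finset.mem_filter, Finset.mem_univ, true_and, Finset.mem_singleton]
  constructor
  · intro h
    have hfix : ∀ x, x ≠ a → x ≠ a' → x ≠ b → x ≠ b' → σ x = x := by
      intro x h1 h2 h3 h4
      simp only [Ne, Fin.ext_iff] at h1 h2 h3 h4
      apply apply_eq_self_of_notMem_nonCuts
      · simp [h, Fin.ext_iff, h1, h3]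
      · intro j hj
        simp only [h, Finset.mem_insert, Finset.mem_singleton, Fin.ext_iff]
        omega
    have key : ∀ p p' : Fin n, (p' : ℕ) = p + 1 → (p = a ∨ p = b) → σ p = p' ∧ σ p' = p := by
      intro p p' hp hpab
      have hcut' : p' ∉ nonCuts σ := by
        simp only [h, Finset.mem_insert, Finset.mem_singleton, Fin.ext_iff]
        simp only [Fin.ext_iff] at hpab
        omega
      have hpre : ∀ j : Fin n, (j : ℕ) + 1 = p → j ∉ nonCuts σ := by
        intro j hj
        simp only [h, Finset.mem_insert, Finset.mem_singleton, Fin.ext_iff]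
        simp only [Fin.ext_iff] at hpab
        omega
      have hlow : ∀ x, p ≤ σ x ↔ p ≤ x := by
        intro x
        by_cases h0 : (p : ℕ) = 0
        · simp only [Fin.le_def]; omega
        · have := notMem_nonCuts.mp (hpre ⟨p - 1, by omega⟩ (by simp; omega)) x
          simp only [Fin.le_def] at *
          omega
      have hup := notMem_nonCuts.mp hcut'
      have r1 : ∀ x, x = p ∨ x = p' → σ x = p ∨ σ x = p' := by
        intro x hx
        have := hlow x
        have := hup x
        simp only [Fin.le_def, Fin.ext_iff] at *
        omega
      have hpm : p ∈ nonCuts σ := by rcases hpab with rfl | rfl <;> simp [h]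
      have hne : σ p ≠ p := by
        intro h1
        refine absurd hpm (notMem_nonCuts.mpr fun x => ?_)
        have h2 := hlow x
        have h3 : σ x = p ↔ x = p := by
          constructor
          · exact fun h' => σ.injective (h'.trans h1.symm)
          · rintro rfl; exact h1
        have h4 := hlow x
        have h5 : p ≤ p := le_rfl
        simp only [Fin.le_def, Fin.ext_iff] at *
        omega
      have e1 : σ p = p' := (r1 p (Or.inl rfl)).resolve_left hne
      refine ⟨e1, (r1 p' (Or.inr rfl)).resolve_right fun h2 => ?_⟩
      have := σ.injective (e1.trans h2.symm)
      rw [Fin.ext_iff] at this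
      omega
    obtain ⟨a1, a2⟩ := key a a' ha (Or.inl rfl)
    obtain ⟨b1, b2⟩ := key b b' hb (Or.inr rfl)
    ext1 x
    simp only [Equiv.Perm.mul_apply, Equiv.swap_apply_def]
    by_cases x1 : x = a
    · subst x1
      rw [a1]
      simp only [Fin.ext_iff] at *
      split_ifs <;> omega
    by_cases x2 : x = a'
    · subst x2
      rw [a2]
      simp only [Fin.ext_iff] at *
      split_ifs <;> omega
    by_cases x3 : x = b
    · subst x3
      rw [b1]
      simp only [Fin.ext_iff] at *
      split_ifs <;> omega
    by_cases x4 : x = b'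
    · subst x4
      rw [b2]
      simp only [Fin.ext_iff] at *
      split_ifs <;> omega
    rw [hfix x x1 x2 x3 x4]
    simp [x1, x2, x3, x4]
  · rintro rfl
    exact nonCuts_swap_mul_swap_of_lt ha hb hab

end NonCuts

/-! ### The connection set, its generation of the symmetric group, and the quotient matrix. -/

/-- The permutations of `Fin n` for which exactly two initial segments are not preserved. -/
def twoNonCuts (n : ℕ) : Finset (Equiv.Perm (Fin n)) :=
  {σ | (nonCuts σ).card = 2}

theorem mem_twoNonCuts {n : ℕ} {σ : Equiv.Perm (Fin n)} :
    σ ∈ twoNonCuts n ↔ (nonCuts σ).card = 2 := by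
  simp [twoNonCuts]

theorem inv_mem_twoNonCuts {n : ℕ} : ∀ σ ∈ twoNonCuts n, σ⁻¹ ∈ twoNonCuts n := by
  intro σ hσ
  rw [mem_twoNonCuts] at *
  rw [nonCuts_inv, hσ]

theorem mem_reducibleSet {n : ℕ} (h2 : 0 < 2) (hn : 2 < n) {σ : Equiv.Perm (Fin n)} :
    σ ∈ (reducibleSet n 2 h2 hn).carrier ↔ σ ∈ twoNonCuts n := by
  show IsMaximallyReducible σ (n - 2) ↔ _
  rw [isMaximallyReducible_iff, mem_twoNonCuts]
  omega

theorem closure_reducibleSet {n : ℕ} (h2 : 0 < 2) (hn : 2 < n) :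
    Subgroup.closure (reducibleSet n 2 h2 hn).carrier = ⊤ := by
  obtain ⟨m, rfl⟩ : ∃ m, n = m + 1 := ⟨n - 1, by omega⟩
  set H := Subgroup.closure (reducibleSet (m + 1) 2 h2 hn).carrier with hH
  have hmem : ∀ (a b c : Fin (m + 1)) (hab : (b : ℕ) = a + 1) (hbc : (c : ℕ) = b + 1),
      Equiv.swap a c ∈ H ∧ Equiv.swap a b * Equiv.swap b c ∈ H := by
    intro a b c hab hbc
    have nab : a ≠ b := by rw [Ne, Fin.ext_iff]; omega
    constructor <;> refine Subgroup.subset_closure ((mem_reducibleSet h2 hn).mpr ?_) <;>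
      rw [mem_twoNonCuts]
    · rw [nonCuts_swap hab hbc, Finset.card_pair nab]
    · rw [nonCuts_swap_mul_swap hab hbc, Finset.card_pair nab]
  have hsw : ∀ (a b c : Fin (m + 1)) (hab : (b : ℕ) = a + 1) (hbc : (c : ℕ) = b + 1),
      Equiv.swap a b ∈ H ∧ Equiv.swap b c ∈ H := by
    intro a b c hab hbc
    have nab : a ≠ b := by rw [Ne, Fin.ext_iff]; omega
    have nac : a ≠ c := by rw [Ne, Fin.ext_iff]; omega
    have nbc : b ≠ c := by rw [Ne, Fin.ext_iff]; omega
    obtain ⟨h1, h2⟩ := hmem a b c hab hbc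
    -- A transposition times a 3-cycle on three consecutive points gives an adjacent transposition,
    -- and these generate the group.
    have e1 : Equiv.swap a b = Equiv.swap a c * (Equiv.swap a b * Equiv.swap b c) := by
      ext1 x
      simp only [Equiv.Perm.mul_apply, Equiv.swap_apply_def]
      split_ifs <;> simp_all
    have h3 : Equiv.swap a b ∈ H := by
      rw [e1]; exact H.mul_mem h1 h2
    refine ⟨h3, ?_⟩
    have e2 : Equiv.swap b c = Equiv.swap a b * (Equiv.swap a b * Equiv.swap b c) := by
      rw [← mul_assoc, Equiv.swap_mul_self, one_mul]
    rw [e2]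
    exact H.mul_mem h3 h2
  rw [eq_top_iff, ← Subgroup.toSubmonoid_le, Subgroup.top_toSubmonoid,
    ← Equiv.Perm.mclosure_swap_castSucc_succ, Submonoid.closure_le]
  rintro _ ⟨i, rfl⟩
  show Equiv.swap i.castSucc i.succ ∈ H
  by_cases hi : (i : ℕ) + 1 < m
  · exact (hsw i.castSucc i.succ ⟨i + 2, by omega⟩ (by simp) (by simp)).1
  · have := i.2
    exact (hsw ⟨i - 1, by omega⟩ i.castSucc i.succ (by simp; omega) (by simp)).2

open Classical in
theorem adjMatrix_cayleyGraph {n : ℕ} (h2 : 0 < 2) (hn : 2 < n) :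
    (cayleyGraph (reducibleSet n 2 h2 hn)).adjMatrix ℝ =
      actionMatrix (Equiv.Perm (Fin n)) (twoNonCuts n) := by
  ext g h
  rw [SimpleGraph.adjMatrix_apply, actionMatrix]
  have : ({σ ∈ twoNonCuts n | σ • g = h} : Finset (Equiv.Perm (Fin n))) =
      if (cayleyGraph (reducibleSet n 2 h2 hn)).Adj g h then {h * g⁻¹} else ∅ := by
    split_ifs with hadj
    · obtain ⟨σ, hσ, rfl⟩ := hadj
      rw [mem_reducibleSet] at hσ
      ext τ
      simp only [Finset.mem_filter, smul_eq_mul, mul_left_inj, Finset.mem_singleton,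
        mul_inv_cancel_right]
      exact ⟨fun h => h.2, fun h => ⟨h ▸ hσ, h⟩⟩
    · rw [Finset.filter_eq_empty_iff]
      rintro σ hσ rfl
      exact hadj ⟨σ, (mem_reducibleSet h2 hn).mpr hσ, rfl⟩
  rw [this]
  split_ifs <;> simp

theorem schreierMatrix_reducibleSet {n : ℕ} (h2 : 0 < 2) (hn : 2 < n) :
    schreierMatrix (reducibleSet n 2 h2 hn) = actionMatrix (Fin n) (twoNonCuts n) := by
  ext i j
  simp only [schreierMatrix, actionMatrix, Nat.cast_inj]
  rw [← Set.ncard_coe_finset]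
  congr 1
  ext σ
  rw [Set.mem_ofPred_eq, mem_reducibleSet, Finset.mem_coe, Finset.mem_filter,
    Equiv.Perm.smul_def]

theorem mem_stabCoset {n : ℕ} {k i : Fin n} {g : Equiv.Perm (Fin n)} :
    g ∈ stabCoset k i ↔ g k = i := by
  rw [stabCoset, Set.mem_smul_set_iff_inv_smul_mem, SetLike.mem_coe, MulAction.mem_stabilizer_iff,
    smul_eq_mul, Equiv.Perm.smul_def, Equiv.Perm.mul_apply, Equiv.swap_inv]
  constructor
  · intro h
    have := congrArg (Equiv.swap k i) h
    simpa using this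
  · rintro rfl
    simp

theorem isQuotientMatrix_stabCoset {n : ℕ} (S : ConnectionSet (Equiv.Perm (Fin n))) (k : Fin n) :
    IsQuotientMatrix (cayleyGraph S) (stabCoset k) (schreierMatrix S) := by
  refine ⟨fun i => ⟨Equiv.swap k i, mem_stabCoset.mpr (by simp)⟩, ?_, ?_, ?_⟩
  · intro i j hij
    rw [Set.disjoint_left]
    intro g h1 h2
    exact hij ((mem_stabCoset.mp h1).symm.trans (mem_stabCoset.mp h2))
  · ext g
    simp [mem_stabCoset]
  · intro i j v hv
    rw [mem_stabCoset] at hv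
    rw [schreierMatrix, Nat.cast_inj]
    have : {w ∈ stabCoset k j | (cayleyGraph S).Adj v w} =
        (fun σ => σ * v) '' {σ ∈ S.carrier | σ i = j} := by
      ext w
      simp only [Set.mem_ofPred_eq, mem_stabCoset, Set.mem_image]
      constructor
      · rintro ⟨hw, σ, hσ, rfl⟩
        refine ⟨σ, ⟨hσ, ?_⟩, rfl⟩
        rw [← hw, Equiv.Perm.mul_apply, hv]
      · rintro ⟨σ, ⟨hσ, h⟩, rfl⟩
        refine ⟨?_, σ, hσ, rfl⟩
        rw [Equiv.Perm.mul_apply, hv, h]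
    rw [this, Set.ncard_image_of_injective _ (mul_left_injective v)]

/-! ### Full flags as permutations. -/

section Flag

variable {n : ℕ}

/-- The full flag whose `i`-th member is the preimage of `{x | x ≤ i}` under `g`. -/
def permFlag (g : Equiv.Perm (Fin n)) : FullFlag n :=
  ⟨fun i => (Finset.Iic i).map g.symm.toEmbedding, fun i => by simp, by
    intro i j hij
    exact Finset.map_ssubset_map.mpr (Finset.Iic_ssubset_Iic.mpr hij)⟩

theorem mem_permFlag (g : Equiv.Perm (Fin n)) (i x : Fin n) :
    x ∈ (permFlag g).1 i ↔ g x ≤ i := by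
  show x ∈ (Finset.Iic i).map g.symm.toEmbedding ↔ _
  rw [Finset.mem_map_equiv]
  simp

theorem permFlag_apply_eq_iff (g h : Equiv.Perm (Fin n)) (i : Fin n) :
    (permFlag g).1 i = (permFlag h).1 i ↔ i ∉ nonCuts (h * g⁻¹) := by
  rw [notMem_nonCuts, Finset.ext_iff]
  simp only [mem_permFlag]
  constructor
  · intro H x
    have := H (g⁻¹ x)
    simpa using this.symm
  · intro H x
    have := H (g x)
    simpa using this.symm

theorem permFlag_injective : Function.Injective (permFlag (n := n)) := by
  intro g h hgh
  have hle : ∀ i x, g x ≤ i ↔ h x ≤ i := fun i x => by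
    rw [← mem_permFlag, ← mem_permFlag, hgh]
  ext1 x
  exact le_antisymm ((hle _ x).mpr le_rfl) ((hle _ x).mp le_rfl)

theorem permFlag_surjective : Function.Surjective (permFlag (n := n)) := by
  classical
  intro U
  have hlast : ∀ x : Fin n, ∃ i, x ∈ U.1 i := by
    intro x
    have hx := x.2
    refine ⟨⟨n - 1, by omega⟩, ?_⟩
    have : U.1 ⟨n - 1, by omega⟩ = Finset.univ := by
      rw [← Finset.card_eq_iff_eq_univ, U.2.1, Fintype.card_fin]
      simp
      omega
    rw [this]
    exact Finset.mem_univ x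
  have hmin : ∀ x : Fin n, ∃ i, x ∈ U.1 i ∧ ∀ j, x ∈ U.1 j → i ≤ j := by
    intro x
    obtain ⟨i, hi, h⟩ := ({i | x ∈ U.1 i} : Finset (Fin n)).exists_min_image id
      (by obtain ⟨i, hi⟩ := hlast x; exact ⟨i, by simpa using hi⟩)
    exact ⟨i, by simpa using hi, fun j hj => h j (by simpa using hj)⟩
  -- `f x` is the first index at which x enters the flag. It is surjective because every step of the
  -- flag adds an element.
  choose f hf hfmin using hmin
  have hfU : ∀ x i, f x ≤ i ↔ x ∈ U.1 i := fun x i =>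
    ⟨fun h => U.2.2.monotone h (hf x), hfmin x i⟩
  have hsurj : Function.Surjective f := by
    intro i
    by_cases h0 : (i : ℕ) = 0
    · have : (U.1 i).Nonempty := by
        rw [← Finset.card_pos, U.2.1]; omega
      obtain ⟨x, hx⟩ := this
      refine ⟨x, ?_⟩
      have := (hfU x i).mpr hx
      rw [Fin.ext_iff]
      rw [Fin.le_def] at this
      omega
    · have hlt : (⟨i - 1, by omega⟩ : Fin n) < i := by
        rw [Fin.lt_def]; simp; omega
      obtain ⟨x, hx, hx'⟩ := Finset.exists_of_ssubset (U.2.2 hlt)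
      refine ⟨x, ?_⟩
      rw [← hfU] at hx hx'
      rw [Fin.le_def] at hx hx'
      rw [Fin.ext_iff]
      simp at hx'
      omega
  have hbij : Function.Bijective f := ⟨Finite.injective_iff_surjective.mpr hsurj, hsurj⟩
  refine ⟨Equiv.ofBijective f hbij, ?_⟩
  apply Subtype.ext
  funext i
  ext x
  rw [mem_permFlag, Equiv.ofBijective_apply, hfU]

theorem permFlag_bijective : Function.Bijective (permFlag (n := n)) :=
  ⟨permFlag_injective, permFlag_surjective⟩

/-- The Cayley graph of the permutations with two non-cuts is the full-flag Johnson graph. -/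
noncomputable def cayleyGraphIso (h2 : 0 < 2) (hn : 2 < n) :
    cayleyGraph (reducibleSet n 2 h2 hn) ≃g fullFlagJohnsonGraph n 2 where
  toEquiv := Equiv.ofBijective permFlag permFlag_bijective
  map_rel_iff' := by
    intro g h
    simp only [Equiv.ofBijective_apply]
    have hset : {i : Fin n | (permFlag g).1 i ≠ (permFlag h).1 i} = ↑(nonCuts (h * g⁻¹)) := by
      ext i
      rw [Set.mem_ofPred_eq, Ne, permFlag_apply_eq_iff, not_not, Finset.mem_coe]
    show (permFlag g ≠ permFlag h ∧ _) ↔ ∃ σ ∈ _, _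
    rw [hset, Set.ncard_coe_finset]
    constructor
    · rintro ⟨-, hc⟩
      exact ⟨h * g⁻¹, (mem_reducibleSet h2 hn).mpr (mem_twoNonCuts.mpr hc), by group⟩
    · rintro ⟨σ, hσ, rfl⟩
      rw [mem_reducibleSet, mem_twoNonCuts] at hσ
      rw [mul_inv_cancel_right]
      refine ⟨fun h0 => ?_, hσ⟩
      have h1 := permFlag_injective h0
      have : σ = 1 := by simpa using h1.symm
      subst this
      have : nonCuts (1 : Equiv.Perm (Fin n)) = ∅ := by simp [nonCuts]
      rw [this] at hσ
      simp at hσ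

end Flag

/-! ### Point stabilisers as copies of the smaller symmetric group. -/

section Embedding

variable {n : ℕ}

theorem viaEmbeddingHom_apply (e : Fin n ↪ Fin (n + 1)) (σ : Equiv.Perm (Fin n)) (x : Fin n) :
    Equiv.Perm.viaEmbeddingHom e σ (e x) = e (σ x) :=
  Equiv.Perm.viaEmbedding_apply σ e x

theorem viaEmbeddingHom_apply_of_notMem (e : Fin n ↪ Fin (n + 1)) (σ : Equiv.Perm (Fin n))
    {x : Fin (n + 1)} (hx : x ∉ Set.range e) : Equiv.Perm.viaEmbeddingHom e σ x = x :=
  Equiv.Perm.viaEmbedding_apply_of_notMem σ e x hx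

theorem nonCuts_viaEmbeddingHom_castSucc (σ : Equiv.Perm (Fin n)) :
    nonCuts (Equiv.Perm.viaEmbeddingHom Fin.castSuccEmb σ) = (nonCuts σ).map Fin.castSuccEmb := by
  have h1 := viaEmbeddingHom_apply Fin.castSuccEmb σ
  simp only [Fin.coe_castSuccEmb] at h1
  ext i
  rw [mem_nonCuts, Finset.mem_map]
  constructor
  · rintro ⟨x, hx, hlt⟩
    cases x using Fin.lastCases with
    | last =>
      rw [viaEmbeddingHom_apply_of_notMem] at hlt
      · exact absurd hlt (not_lt.mpr hx)
      · rintro ⟨y, hy⟩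
        exact absurd hy (Fin.castSucc_lt_last y).ne
    | cast x =>
      rw [h1] at hlt
      cases i using Fin.lastCases with
      | last => exact absurd hlt (not_lt.mpr (Fin.le_last _))
      | cast i => exact ⟨i, mem_nonCuts.mpr ⟨x, hx, hlt⟩, rfl⟩
  · rintro ⟨j, hj, rfl⟩
    obtain ⟨x, hx, hlt⟩ := mem_nonCuts.mp hj
    exact ⟨x.castSucc, hx, by rw [h1]; exact hlt⟩

theorem nonCuts_viaEmbeddingHom_succ (σ : Equiv.Perm (Fin n)) :
    nonCuts (Equiv.Perm.viaEmbeddingHom (Fin.succEmb n) σ) = (nonCuts σ).map (Fin.succEmb n) := by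
  have h1 := viaEmbeddingHom_apply (Fin.succEmb n) σ
  simp only [Fin.coe_succEmb] at h1
  have h0 : Equiv.Perm.viaEmbeddingHom (Fin.succEmb n) σ 0 = 0 := by
    apply viaEmbeddingHom_apply_of_notMem
    rintro ⟨y, hy⟩
    exact absurd hy (Fin.succ_ne_zero y)
  ext i
  rw [mem_nonCuts, Finset.mem_map]
  constructor
  · rintro ⟨x, hx, hlt⟩
    cases x using Fin.cases with
    | zero =>
      rw [h0] at hlt
      exact absurd hlt (not_lt.mpr (Fin.zero_le _))
    | succ x =>
      rw [h1] at hlt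
      cases i using Fin.cases with
      | zero => exact absurd hx (not_le.mpr (Fin.succ_pos x))
      | succ i =>
        exact ⟨i, mem_nonCuts.mpr ⟨x, Fin.succ_le_succ_iff.mp hx, Fin.succ_lt_succ_iff.mp hlt⟩, rfl⟩
  · rintro ⟨j, hj, rfl⟩
    obtain ⟨x, hx, hlt⟩ := mem_nonCuts.mp hj
    exact ⟨x.succ, Fin.succ_le_succ_iff.mpr hx, by
      rw [h1]; exact Fin.succ_lt_succ_iff.mpr hlt⟩

theorem exists_viaEmbeddingHom_eq {e : Fin n ↪ Fin (n + 1)} {b : Fin (n + 1)}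
    (hb : ∀ x, x ∈ Set.range e ↔ x ≠ b) {g : Equiv.Perm (Fin (n + 1))} (hg : g b = b) :
    ∃ σ, Equiv.Perm.viaEmbeddingHom e σ = g := by
  have hmem : ∀ y, ∃ z, e z = g (e y) := by
    intro y
    apply (hb _).mpr
    intro h
    have := g.injective (h.trans hg.symm)
    exact (hb (e y)).mp ⟨y, rfl⟩ this
  choose f hf using hmem
  have hinj : Function.Injective f := by
    intro y z hyz
    apply e.injective
    apply g.injective
    rw [← hf, ← hf, hyz]
  have hbij : Function.Bijective f := ⟨hinj, Finite.injective_iff_surjective.mp hinj⟩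
  refine ⟨Equiv.ofBijective f hbij, ?_⟩
  ext1 x
  by_cases hx : x = b
  · rw [viaEmbeddingHom_apply_of_notMem, hx, hg]
    rw [hb, not_not, hx]
  · obtain ⟨y, rfl⟩ := (hb x).mpr hx
    rw [viaEmbeddingHom_apply, Equiv.ofBijective_apply, hf]

end Embedding

/-! ### The Dirichlet form on [n] as a form in the increments. -/

section Displacement

variable {α : Type*} [Fintype α] [DecidableEq α]

theorem sum_displacement_swap (F : α → ℝ) {a c : α} (hac : a ≠ c) :
    ∑ x, (F (Equiv.swap a c x) - F x) ^ 2 = 2 * (F c - F a) ^ 2 := by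
  rw [← Finset.sum_subset (Finset.subset_univ {a, c})]
  · rw [Finset.sum_pair hac]
    simp
    ring
  · intro x _ hx
    simp only [Finset.mem_insert, Finset.mem_singleton, not_or] at hx
    rw [Equiv.swap_apply_of_ne_of_ne hx.1 hx.2]
    ring

theorem sum_displacement_swap_mul_swap (F : α → ℝ) {a b c : α} (hab : a ≠ b) (hac : a ≠ c)
    (hbc : b ≠ c) :
    ∑ x, (F ((Equiv.swap a b * Equiv.swap b c) x) - F x) ^ 2 =
      (F b - F a) ^ 2 + (F c - F b) ^ 2 + (F c - F a) ^ 2 := by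
  rw [← Finset.sum_subset (Finset.subset_univ {a, b, c})]
  · rw [Finset.sum_insert (by simp [hab, hac]), Finset.sum_pair hbc]
    simp [Equiv.swap_apply_def, hab, hac, hac.symm, hbc.symm]
    ring
  · intro x _ hx
    simp only [Finset.mem_insert, Finset.mem_singleton, not_or] at hx
    simp [Equiv.swap_apply_def, hx]

theorem sum_displacement_swap_mul_swap_disjoint (F : α → ℝ) {a a' b b' : α} (haa : a ≠ a')
    (hab : a ≠ b) (hab' : a ≠ b') (ha'b : a' ≠ b) (ha'b' : a' ≠ b') (hbb : b ≠ b') :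
    ∑ x, (F ((Equiv.swap a a' * Equiv.swap b b') x) - F x) ^ 2 =
      2 * (F a' - F a) ^ 2 + 2 * (F b' - F b) ^ 2 := by
  rw [← Finset.sum_subset (Finset.subset_univ {a, a', b, b'})]
  · rw [Finset.sum_insert (by simp [haa, hab, hab']), Finset.sum_insert (by simp [ha'b, ha'b']),
      Finset.sum_pair hbb]
    simp [Equiv.swap_apply_def, hab, hab', ha'b, ha'b', hab.symm, hab'.symm, ha'b.symm,
      ha'b'.symm]
    ring
  · intro x _ hx
    simp only [Finset.mem_insert, Finset.mem_singleton, not_or] at hx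
    simp [Equiv.swap_apply_def, hx]

end Displacement

theorem sum_ite_eq_pair {n : ℕ} (s : Finset (Fin n)) (x : ℝ) :
    ∑ q : Fin n, ∑ p ∈ Finset.Iio q, (if s = {p, q} then x else 0) =
      if s.card = 2 then x else 0 := by
  split_ifs with hs
  · obtain ⟨a, b, hlt, rfl⟩ : ∃ a b : Fin n, a < b ∧ s = {a, b} := by
      obtain ⟨a, b, hne, rfl⟩ := Finset.card_eq_two.mp hs
      rcases lt_or_gt_of_ne hne with h | h
      · exact ⟨a, b, h, rfl⟩
      · exact ⟨b, a, h, Finset.pair_comm a b⟩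
    have key : ∀ p q : Fin n, p < q → ({a, b} : Finset (Fin n)) = {p, q} → p = a ∧ q = b := by
      intro p q hpq h
      have h1 : p ∈ ({a, b} : Finset (Fin n)) := by rw [h]; simp
      have h2 : q ∈ ({a, b} : Finset (Fin n)) := by rw [h]; simp
      simp only [Finset.mem_insert, Finset.mem_singleton, Fin.ext_iff, Fin.lt_def] at *
      omega
    rw [Finset.sum_eq_single b, Finset.sum_eq_single a]
    · simp
    · intro p hp hpa
      rw [if_neg]
      exact fun h => hpa (key p b (Finset.mem_Iio.mp hp) h).1
    · intro h
      exact absurd (Finset.mem_Iio.mpr hlt) h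
    · intro q _ hq
      refine Finset.sum_eq_zero fun p hp => ?_
      rw [if_neg]
      exact fun h => hq (key p q (Finset.mem_Iio.mp hp) h).2
    · simp
  · refine Finset.sum_eq_zero fun q _ => Finset.sum_eq_zero fun p hp => ?_
    rw [if_neg]
    rintro rfl
    exact hs (Finset.card_pair (Finset.mem_Iio.mp hp).ne)

theorem sum_twoNonCuts {n : ℕ} (ψ : Equiv.Perm (Fin n) → ℝ) :
    ∑ σ ∈ twoNonCuts n, ψ σ =
      ∑ q : Fin n, ∑ p ∈ Finset.Iio q, ∑ σ with nonCuts σ = {p, q}, ψ σ := by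
  have h1 : ∀ q : Fin n, ∑ p ∈ Finset.Iio q, ∑ σ with nonCuts σ = {p, q}, ψ σ =
      ∑ σ, ∑ p ∈ Finset.Iio q, (if nonCuts σ = {p, q} then ψ σ else 0) := by
    intro q
    rw [Finset.sum_comm]
    exact Finset.sum_congr rfl fun p _ => Finset.sum_filter _ _
  simp only [h1]
  rw [Finset.sum_comm]
  simp only [sum_ite_eq_pair]
  rw [twoNonCuts, Finset.sum_filter]

theorem sum_Iio_fin {n : ℕ} (q : Fin n) (H : ℕ → ℝ) :
    ∑ p ∈ Finset.Iio q, H p = ∑ p ∈ Finset.range q, H p := by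
  rw [← Nat.Iio_eq_range, ← Fin.map_valEmbedding_Iio, Finset.sum_map]
  rfl

theorem sum_range_sum_range_add (m : ℕ) (a : ℕ → ℝ) :
    ∑ q ∈ Finset.range m, ∑ p ∈ Finset.range q, (a p + a q) =
      (m - 1) * ∑ p ∈ Finset.range m, a p := by
  induction m with
  | zero => simp
  | succ m ih =>
    rw [Finset.sum_range_succ, ih, Finset.sum_range_succ _ m, Finset.sum_add_distrib,
      Finset.sum_const, Finset.card_range, nsmul_eq_mul]
    push_cast
    ring

theorem sum_range_sum_range_ite (m : ℕ) (u : ℕ → ℝ) :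
    ∑ q ∈ Finset.range m, ∑ p ∈ Finset.range q, (if q = p + 1 then u p else 0) =
      ∑ p ∈ Finset.range (m - 1), u p := by
  induction m with
  | zero => simp
  | succ m ih =>
    rw [Finset.sum_range_succ, ih]
    cases m with
    | zero => simp
    | succ k =>
      simp only [Nat.add_right_cancel_iff, Nat.add_sub_cancel]
      rw [Finset.sum_range_succ _ k]
      simp [Finset.sum_range_succ]

/-- The Dirichlet form of the Schreier graph of `[N]`, in terms of the increments of `f`. -/
noncomputable def pathForm (N : ℕ) (f : ℕ → ℝ) : ℝ :=
  ((N : ℝ) - 2) * ∑ p ∈ Finset.range (N - 1), (f (p + 1) - f p) ^ 2 +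
    2 * ∑ p ∈ Finset.range (N - 2), (f (p + 2) - f p) ^ 2

theorem last_notMem_nonCuts {m : ℕ} (σ : Equiv.Perm (Fin (m + 1))) :
    Fin.last m ∉ nonCuts σ := by
  rw [mem_nonCuts]
  rintro ⟨x, -, h⟩
  exact absurd h (not_lt.mpr (Fin.le_last _))

/-- Group the connection set by its pair of non-cuts. Every pair p < q contributes the squared
increments at p and q. An adjacent pair, having three permutations instead of one, contributes in
addition twice the square of `f (p + 2) - f p`. Each of the N - 1 increments lies in N - 2 pairs. -/
theorem actionEnergy_twoNonCuts (m : ℕ) (f : ℕ → ℝ) :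
    actionEnergy (twoNonCuts (m + 1)) (fun i : Fin (m + 1) => f i) = pathForm (m + 1) f := by
  set F : Fin (m + 1) → ℝ := fun i => f i with hF
  have hpair : ∀ p q : Fin (m + 1), p < q → (hq : (q : ℕ) < m) →
      ∑ σ with nonCuts σ = {p, q}, ∑ x, (F (σ • x) - F x) ^ 2 =
      2 * (((f (p + 1) - f p) ^ 2 + (f (q + 1) - f q) ^ 2) +
        if (q : ℕ) = p + 1 then 2 * (f (p + 2) - f p) ^ 2 else 0) := by
    intro p q hpq hq
    rw [Fin.lt_def] at hpq
    simp only [Equiv.Perm.smul_def]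
    by_cases h : (q : ℕ) = p + 1
    · set r : Fin (m + 1) := ⟨p + 2, by omega⟩ with hr
      have hqr : (r : ℕ) = q + 1 := by simp [hr, h]
      have n1 : p ≠ q := by rw [Ne, Fin.ext_iff]; omega
      have n2 : p ≠ r := by rw [Ne, Fin.ext_iff]; omega
      have n3 : q ≠ r := by rw [Ne, Fin.ext_iff]; omega
      rw [filter_nonCuts_eq_of_adjacent h hqr, if_pos h]
      have d1 : Equiv.swap p r ≠ Equiv.swap p q * Equiv.swap q r := by
        intro h'
        have := congrArg (fun σ => σ p) h'
        simp [Equiv.swap_apply_def, n1, n2, n3.symm] at this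
      have d2 : Equiv.swap p r ≠ Equiv.swap q r * Equiv.swap p q := by
        intro h'
        have := congrArg (fun σ => σ q) h'
        simp [Equiv.swap_apply_def, n1, n1.symm, n2, n3] at this
      have d3 : Equiv.swap p q * Equiv.swap q r ≠ Equiv.swap q r * Equiv.swap p q := by
        intro h'
        have := congrArg (fun σ => σ p) h'
        simp [Equiv.swap_apply_def, n1, n2, n3] at this
      rw [Finset.sum_insert (by simp [d1, d2]), Finset.sum_pair d3, sum_displacement_swap F n2,
        sum_displacement_swap_mul_swap F n1 n2 n3]
      -- The inverse 3-cycle has the shape of the first with the three points in reverse order, so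
      -- the same displacement formula applies.
      rw [show Equiv.swap q r * Equiv.swap p q = Equiv.swap r q * Equiv.swap q p by
        rw [Equiv.swap_comm q r, Equiv.swap_comm p q]]
      rw [sum_displacement_swap_mul_swap F n3.symm n2.symm n1.symm]
      simp only [hF, hqr, h]
      ring
    · set p' : Fin (m + 1) := ⟨p + 1, by omega⟩ with hp'
      set q' : Fin (m + 1) := ⟨q + 1, by omega⟩ with hq'
      have e1 : (p' : ℕ) = p + 1 := rfl
      have e2 : (q' : ℕ) = q + 1 := rfl
      rw [filter_nonCuts_eq_of_lt e1 e2 (by rw [Fin.lt_def]; omega), if_neg h,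
        Finset.sum_singleton, sum_displacement_swap_mul_swap_disjoint]
      · simp only [hF, e1, e2]
        ring
      all_goals rw [Ne, Fin.ext_iff]; omega
  have hlast : ∀ p : Fin (m + 1),
      ∑ σ with nonCuts σ = {p, Fin.last m}, ∑ x, (F (σ • x) - F x) ^ 2 = 0 := by
    intro p
    rw [Finset.filter_eq_empty_iff.mpr, Finset.sum_empty]
    intro σ _ h
    exact last_notMem_nonCuts σ (by rw [h]; simp)
  rw [actionEnergy, sum_twoNonCuts, Fin.sum_univ_castSucc]
  rw [Finset.sum_eq_zero (s := Finset.Iio (Fin.last m)) fun p _ => hlast p, add_zero]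
  have hrow : ∀ q : Fin m, ∑ p ∈ Finset.Iio q.castSucc,
      ∑ σ with nonCuts σ = {p, q.castSucc}, ∑ x, (F (σ • x) - F x) ^ 2 =
      ∑ p ∈ Finset.range q, 2 * (((f (p + 1) - f p) ^ 2 + (f (q + 1) - f q) ^ 2) +
        if (q : ℕ) = p + 1 then 2 * (f (p + 2) - f p) ^ 2 else 0) := by
    intro q
    rw [← Fin.val_castSucc q, ← sum_Iio_fin]
    refine Finset.sum_congr rfl fun p hp => ?_
    rw [hpair p q.castSucc (Finset.mem_Iio.mp hp) (by simp)]
  rw [Finset.sum_congr rfl fun q _ => hrow q]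
  rw [Fin.sum_univ_eq_sum_range (fun q => ∑ p ∈ Finset.range q,
    2 * (((f (p + 1) - f p) ^ 2 + (f (q + 1) - f q) ^ 2) +
        if (q : ℕ) = p + 1 then 2 * (f (p + 2) - f p) ^ 2 else 0))]
  simp only [← Finset.mul_sum]
  simp only [Finset.sum_add_distrib (f := fun p => (f (p + 1) - f p) ^ 2 + _)]
  rw [Finset.sum_add_distrib, sum_range_sum_range_add m (fun p => (f (p + 1) - f p) ^ 2),
    sum_range_sum_range_ite m (fun p => 2 * (f (p + 2) - f p) ^ 2), pathForm, Nat.add_sub_cancel,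
    show m + 1 - 2 = m - 1 by omega, ← Finset.mul_sum]
  push_cast
  ring

/-- The energy ignores constants, so the mean can be subtracted. This admits test functions whose
sum is not zero, such as an eigenvector with one entry repeated. -/
theorem IsSpectralGap.mul_variance_le {G X : Type*} [Group G] [MulAction G X] [Fintype X]
    [Nonempty X] {T : Finset G} {γ : ℝ} (h : IsSpectralGap X T γ) (w : X → ℝ) :
    γ * (∑ x, w x ^ 2 - (∑ x, w x) ^ 2 / Fintype.card X) ≤ actionEnergy T w := by
  have hc : (Fintype.card X : ℝ) ≠ 0 := by simp
  set c : ℝ := (∑ x, w x) / Fintype.card X with hcdef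
  have hcs : ∑ x, w x = Fintype.card X * c := by rw [hcdef]; field_simp
  have h1 := h.bound (fun x => w x - c) (by
    rw [Finset.sum_sub_distrib, hcs]; simp)
  have h2 : actionEnergy T (fun x => w x - c) = actionEnergy T w := by
    simp [actionEnergy]
  have h3 : ∑ x, (w x - c) ^ 2 = ∑ x, w x ^ 2 - (∑ x, w x) ^ 2 / Fintype.card X := by
    have : ∀ x, (w x - c) ^ 2 = w x ^ 2 - 2 * c * w x + c ^ 2 := fun x => by ring
    simp only [this, Finset.sum_add_distrib, Finset.sum_sub_distrib, ← Finset.mul_sum]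
    rw [hcs]
    simp
    field_simp
    ring
  rw [h2, h3] at h1
  exact h1

/-! ### Increments of an eigenvector with eigenvalue at most 4. -/

/-- The polarisation of `pathForm`. -/
noncomputable def pathBilin (N : ℕ) (f h : ℕ → ℝ) : ℝ :=
  ((N : ℝ) - 2) * ∑ p ∈ Finset.range (N - 1), (f (p + 1) - f p) * (h (p + 1) - h p) +
    2 * ∑ p ∈ Finset.range (N - 2), (f (p + 2) - f p) * (h (p + 2) - h p)

theorem pathForm_add (N : ℕ) (f h : ℕ → ℝ) :
    pathForm N (fun i => f i + h i) = pathForm N f + 2 * pathBilin N f h + pathForm N h := by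
  have e1 : ∀ p, (f (p + 1) + h (p + 1) - (f p + h p)) ^ 2 = (f (p + 1) - f p) ^ 2
      + 2 * ((f (p + 1) - f p) * (h (p + 1) - h p)) + (h (p + 1) - h p) ^ 2 := fun p => by ring
  have e2 : ∀ p, (f (p + 2) + h (p + 2) - (f p + h p)) ^ 2 = (f (p + 2) - f p) ^ 2
      + 2 * ((f (p + 2) - f p) * (h (p + 2) - h p)) + (h (p + 2) - h p) ^ 2 := fun p => by ring
  simp only [pathForm, pathBilin, e1, e2, Finset.sum_add_distrib, ← Finset.mul_sum]
  ring

/-- Polarising `actionEnergy_twoNonCuts` gives the weak form of the eigenvalue equation, to be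
tested against chosen `h`. -/
theorem pathBilin_eq_of_eigenvector {m : ℕ} {γ : ℝ} {f : ℕ → ℝ}
    (hf : ∀ i : Fin (m + 1), ∑ σ ∈ twoNonCuts (m + 1), (f i - f (σ • i : Fin (m + 1))) = γ * f i)
    (h : ℕ → ℝ) : pathBilin (m + 1) f h = γ * ∑ i ∈ Finset.range (m + 1), f i * h i := by
  set T := twoNonCuts (m + 1)
  set F : Fin (m + 1) → ℝ := fun i => f i
  set H : Fin (m + 1) → ℝ := fun i => h i
  have h1 := sum_mul_laplacian (T := T) inv_mem_twoNonCuts F H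
  have h2 : actionEnergy T (fun i => F i + H i) = actionEnergy T F + actionEnergy T H +
      2 * ((1 / 2) * ∑ σ ∈ T, ∑ x, (F (σ • x) - F x) * (H (σ • x) - H x)) := by
    have : ∀ (σ : Equiv.Perm (Fin (m + 1))) x, (F (σ • x) + H (σ • x) - (F x + H x)) ^ 2 =
      (F (σ • x) - F x) ^ 2 + (H (σ • x) - H x) ^ 2 +
        2 * ((F (σ • x) - F x) * (H (σ • x) - H x)) := fun σ x => by ring
    simp only [actionEnergy, this, Finset.sum_add_distrib, ← Finset.mul_sum]
    ring
  rw [← h1] at h2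
  have h3 : ∑ x, H x * ∑ σ ∈ T, (F x - F (σ • x)) =
      γ * ∑ i ∈ Finset.range (m + 1), f i * h i := by
    rw [Finset.mul_sum, ← Fin.sum_univ_eq_sum_range (fun i => γ * (f i * h i))]
    refine Finset.sum_congr rfl fun x _ => ?_
    rw [hf]
    ring
  have h4 := actionEnergy_twoNonCuts m f
  have h5 := actionEnergy_twoNonCuts m h
  have h6 := actionEnergy_twoNonCuts m (fun i => f i + h i)
  rw [pathForm_add] at h6
  rw [h3] at h2
  change actionEnergy T (fun i => F i + H i) = _ at h6
  change actionEnergy T F = _ at h4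
  change actionEnergy T H = _ at h5
  linarith

theorem sum_mul_sub_by_parts (k : ℕ) (f G : ℕ → ℝ) :
    ∑ i ∈ Finset.range (k + 1), f i * (G i - G (i + 1)) =
      f 0 * G 0 + ∑ p ∈ Finset.range k, (f (p + 1) - f p) * G (p + 1) - f k * G (k + 1) := by
  induction k with
  | zero => simp; ring
  | succ k ih =>
    rw [Finset.sum_range_succ, ih, Finset.sum_range_succ _ k]
    ring

theorem sum_range_pair_le {m i j : ℕ} (g : ℕ → ℝ) (hi0 : i ≠ 0) (hj0 : j ≠ 0) (him : i + 1 < m)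
    (hjm : j + 1 < m) (hij : i ≠ j) :
    g i ^ 2 + g j ^ 2 + (g 0 ^ 2 + g (m - 1) ^ 2) ≤ ∑ p ∈ Finset.range m, g p ^ 2 := by
  have h1 : ∑ p ∈ ({i, j, 0, m - 1} : Finset ℕ), g p ^ 2 =
      g i ^ 2 + g j ^ 2 + (g 0 ^ 2 + g (m - 1) ^ 2) := by
    rw [Finset.sum_insert, Finset.sum_insert, Finset.sum_pair]
    · ring
    · omega
    · simp only [Finset.mem_insert, Finset.mem_singleton]; omega
    · simp only [Finset.mem_insert, Finset.mem_singleton]; omega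
  rw [← h1]
  refine Finset.sum_le_sum_of_subset_of_nonneg ?_ fun _ _ _ => sq_nonneg _
  intro p hp
  simp only [Finset.mem_insert, Finset.mem_singleton, Finset.mem_range] at *
  omega

theorem sum_range_eq_pair {m a b : ℕ} (u : ℕ → ℝ) (hab : a ≠ b) (ha : a < m) (hb : b < m)
    (h : ∀ p < m, p ≠ a → p ≠ b → u p = 0) : ∑ p ∈ Finset.range m, u p = u a + u b := by
  rw [← Finset.sum_pair hab]
  refine (Finset.sum_subset ?_ ?_).symm
  · intro p hp
    simp only [Finset.mem_insert, Finset.mem_singleton, Finset.mem_range] at *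
    omega
  · intro p hp hp'
    simp only [Finset.mem_insert, Finset.mem_singleton, not_or] at hp'
    exact h p (Finset.mem_range.mp hp) hp'.1 hp'.2

section Eigenvector

variable {j : ℕ} {γ : ℝ} {f : ℕ → ℝ}

/-- For an eigenvector of a small eigenvalue the increments are positively correlated. -/
theorem increments_correlation
    (hB : ∀ h : ℕ → ℝ, pathBilin (j + 2) f h = γ * ∑ i ∈ Finset.range (j + 2), f i * h i)
    (hγ : γ ≤ 4) (g : ℕ → ℝ) (hg : ∀ p, g p = f (p + 1) - f p) :
    (2 * (j + 2 : ℝ) - 8) * ∑ p ∈ Finset.range (j + 1), g p ^ 2 ≤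
      (g 0 ^ 2 + g j ^ 2) + (2 * (j + 2 : ℝ) - 4) * ∑ p ∈ Finset.range j, g p * g (p + 1) := by
  set A := ∑ p ∈ Finset.range (j + 1), g p ^ 2 with hA
  set S := ∑ p ∈ Finset.range j, g p * g (p + 1) with hS
  -- `G` is the increment sequence shifted by one and padded by zero at both ends. The test function
  -- `G i - G (i + 1)` is minus a discrete second difference of `f`, and summation by parts leaves
  -- no boundary term.
  set G : ℕ → ℝ := fun p => if p = 0 then 0 else if p ≤ j + 1 then g (p - 1) else 0 with hG
  have G0 : G 0 = 0 := by simp [hG]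
  have G1 : ∀ p, p ≤ j → G (p + 1) = g p := fun p hp => by simp [hG, hp]
  have G2 : G (j + 2) = 0 := by simp [hG]
  have h1 := hB (fun i => G i - G (i + 1))
  have hA0 : 0 ≤ A := Finset.sum_nonneg fun _ _ => sq_nonneg _
  have e1 : ∑ i ∈ Finset.range (j + 2), f i * (G i - G (i + 1)) = A := by
    rw [sum_mul_sub_by_parts, G0, G2, hA]
    simp only [mul_zero, zero_add, sub_zero]
    refine Finset.sum_congr rfl fun p hp => ?_
    rw [G1 p (by have := Finset.mem_range.mp hp; omega), hg]
    ring
  have s1 : ∑ p ∈ Finset.range (j + 1), G (p + 1) * G (p + 2) = S := by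
    rw [Finset.sum_range_succ, G2, mul_zero, add_zero]
    refine Finset.sum_congr rfl fun p hp => ?_
    have := Finset.mem_range.mp hp
    rw [G1 p (by omega), G1 (p + 1) (by omega)]
  have s2 : ∑ p ∈ Finset.range (j + 1), G p * G (p + 1) = S := by
    rw [Finset.sum_range_succ', G0, zero_mul, add_zero]
    refine Finset.sum_congr rfl fun p hp => ?_
    have := Finset.mem_range.mp hp
    rw [G1 p (by omega), G1 (p + 1) (by omega)]
  have s0 : ∑ p ∈ Finset.range (j + 1), G (p + 1) ^ 2 = A := by
    refine Finset.sum_congr rfl fun p hp => ?_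
    have := Finset.mem_range.mp hp
    rw [G1 p (by omega)]
  have e2 : ∑ p ∈ Finset.range (j + 1), (f (p + 1) - f p) *
      (G (p + 1) - G (p + 1 + 1) - (G p - G (p + 1))) = 2 * A - 2 * S := by
    have : ∀ p ∈ Finset.range (j + 1), (f (p + 1) - f p) *
        (G (p + 1) - G (p + 1 + 1) - (G p - G (p + 1))) =
        2 * G (p + 1) ^ 2 - G (p + 1) * G (p + 2) - G p * G (p + 1) := by
      intro p hp
      have := Finset.mem_range.mp hp
      rw [← hg, ← G1 p (by omega)]
      ring
    rw [Finset.sum_congr rfl this, Finset.sum_sub_distrib, Finset.sum_sub_distrib, s1, s2,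
      ← Finset.mul_sum, s0]
    ring
  have e3 : -(1 / 2) * (g 0 ^ 2 + g j ^ 2) ≤ ∑ p ∈ Finset.range j, (f (p + 2) - f p) *
      (G (p + 2) - G (p + 2 + 1) - (G p - G (p + 1))) := by
    rcases Nat.eq_zero_or_pos j with rfl | hj
    · simp
      positivity
    -- Each summand exceeds `t (p + 1) - t p` by half of (G (p + 2) - G p)² + (G (p + 1) - G (p +
    -- 3))². The telescoped boundary value is at least `-(1 / 2) * (g 0 ^ 2 + g j ^ 2)` after
    -- completing squares.
    set t : ℕ → ℝ := fun p => G p * G (p + 1) - G (p + 1) * G (p + 2) + (1 / 2) * G p ^ 2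
      - (1 / 2) * G (p + 2) ^ 2 with ht
    have h2 : ∑ p ∈ Finset.range j, (t (p + 1) - t p) ≤ ∑ p ∈ Finset.range j,
        (f (p + 2) - f p) * (G (p + 2) - G (p + 2 + 1) - (G p - G (p + 1))) := by
      refine Finset.sum_le_sum fun p hp => ?_
      have := Finset.mem_range.mp hp
      have h3 : f (p + 2) - f p = G (p + 1) + G (p + 2) := by
        rw [G1 p (by omega), G1 (p + 1) (by omega), hg, hg]
        ring
      rw [h3]
      simp only [ht]
      show G (p + 1) * G (p + 2) - G (p + 2) * G (p + 3) + (1 / 2) * G (p + 1) ^ 2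
        - (1 / 2) * G (p + 3) ^ 2 - _ ≤ (G (p + 1) + G (p + 2)) *
          (G (p + 2) - G (p + 3) - (G p - G (p + 1)))
      nlinarith [sq_nonneg (G (p + 2) - G p), sq_nonneg (G (p + 1) - G (p + 3))]
    rw [Finset.sum_range_sub] at h2
    refine le_trans ?_ h2
    obtain ⟨i, rfl⟩ : ∃ i, j = i + 1 := ⟨j - 1, by omega⟩
    simp only [ht, G0, G2, zero_add]
    have G11 : G 1 = g 0 := G1 0 (by omega)
    have G12 : G 2 = g 1 := G1 1 (by omega)
    rw [G1 i (by omega), G1 (i + 1) le_rfl, G11, G12]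
    nlinarith [sq_nonneg (g i + g (i + 1)), sq_nonneg (g 0 + g 1)]
  rw [e1] at h1
  simp only [pathBilin, show j + 2 - 1 = j + 1 from rfl, Nat.add_sub_cancel] at h1
  rw [e2] at h1
  push_cast at h1
  have h4 : γ * A ≤ 4 * A := mul_le_mul_of_nonneg_right hγ hA0
  nlinarith

/-- For an eigenvector of a small eigenvalue the two extreme increments are small. -/
theorem extreme_increments_le (hj : 3 ≤ j)
    (hB : ∀ h : ℕ → ℝ, pathBilin (j + 2) f h = γ * ∑ i ∈ Finset.range (j + 2), f i * h i)
    (hγ : γ ≤ 4) (g : ℕ → ℝ) (hg : ∀ p, g p = f (p + 1) - f p) :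
    8 * (g 0 ^ 2 + g j ^ 2) ≤ 5 * ∑ p ∈ Finset.range (j + 1), g p ^ 2 := by
  obtain ⟨k, rfl⟩ : ∃ k, j = k + 3 := ⟨j - 3, by omega⟩
  set A := ∑ p ∈ Finset.range (k + 3 + 1), g p ^ 2 with hA
  have hk : (0 : ℝ) ≤ k := Nat.cast_nonneg k
  -- Difference of the eigenvalue equations at the points 1 and 0; `h2` is its mirror image at the
  -- other end.
  have h1 : (k + 3 : ℝ) * (2 * g 0 - g 1) + 2 * (g 0 - g 2) = γ * g 0 := by
    have := hB (fun i => if i = 0 then -1 else if i = 1 then 1 else 0)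
    simp only [pathBilin, show k + 3 + 2 - 1 = k + 4 from rfl,
      show k + 3 + 2 - 2 = k + 3 from rfl] at this
    rw [sum_range_eq_pair (a := 0) (b := 1), sum_range_eq_pair (a := 0) (b := 1),
      sum_range_eq_pair (a := 0) (b := 1)] at this
    · simp at this
      rw [hg, hg, hg]
      norm_num at this ⊢
      linarith
    all_goals first
      | omega
      | (intro p _ h0 h1
         simp [h0, h1])
  have h2 : (k + 3 : ℝ) * (2 * g (k + 3) - g (k + 2)) + 2 * (g (k + 3) - g (k + 1)) =
      γ * g (k + 3) := by
    have := hB (fun i => if i = k + 3 then -1 else if i = k + 4 then 1 else 0)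
    simp only [pathBilin, show k + 3 + 2 - 1 = k + 4 from rfl,
      show k + 3 + 2 - 2 = k + 3 from rfl] at this
    rw [sum_range_eq_pair (a := k + 2) (b := k + 3), sum_range_eq_pair (a := k + 1) (b := k + 2),
      sum_range_eq_pair (a := k + 3) (b := k + 4)] at this
    · simp at this
      rw [hg, hg, hg]
      norm_num at this ⊢
      linarith
    all_goals first
      | omega
      | (intro p _ h0 h1
         simp only [mul_eq_zero]
         right
         split_ifs <;> first | omega | simp)
  have key : ∀ a b c : ℝ, (k + 3 : ℝ) * (2 * a - b) + 2 * (a - c) = γ * a →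
      (3 * (k + 5 : ℝ) - 12) * a ^ 2 ≤ (k + 3) * b ^ 2 + 2 * c ^ 2 := by
    intro a b c h
    have h3 := congrArg (· * a) h
    beta_reduce at h3
    have h4 : γ * a ^ 2 ≤ 4 * a ^ 2 := mul_le_mul_of_nonneg_right hγ (sq_nonneg a)
    nlinarith [mul_nonneg (by positivity : (0 : ℝ) ≤ k + 3) (sq_nonneg (a - b)),
      sq_nonneg (a - c)]
  have k1 := key _ _ _ h1
  have k2 := key _ _ _ h2
  have p1 := sum_range_pair_le (m := k + 3 + 1) g (i := 1) (j := k + 2) (by omega) (by omega)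
    (by omega) (by omega) (by omega)
  rw [← hA, Nat.add_sub_cancel] at p1
  have p3 := mul_le_mul_of_nonneg_left p1 (by positivity : (0 : ℝ) ≤ k + 3)
  -- The premise says that `(4 * k + 8)` times the end squares is at most `(k + 5) * A`; the
  -- constant 5/8 is this ratio at k = 0, its largest value.
  have fin : (3 * (k + 5 : ℝ) - 12) * (g 0 ^ 2 + g (k + 3) ^ 2) ≤
      (k + 5) * (A - (g 0 ^ 2 + g (k + 3) ^ 2)) → 8 * (g 0 ^ 2 + g (k + 3) ^ 2) ≤ 5 * A := by
    intro h
    have hA0 : 0 ≤ A := Finset.sum_nonneg fun _ _ => sq_nonneg _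
    have : (0 : ℝ) < 4 * k + 8 := by positivity
    have h5 : (4 * k + 8 : ℝ) * (8 * (g 0 ^ 2 + g (k + 3) ^ 2)) ≤ (4 * k + 8) * (5 * A) := by
      nlinarith [mul_nonneg hk hA0]
    exact le_of_mul_le_mul_left h5 this
  apply fin
  -- For k = 1 the indices 2 and k + 1 coincide, so the middle increment occurs twice and
  -- `sum_range_pair_le` does not apply to that pair.
  by_cases hk1 : k = 1
  · subst hk1
    have hA' : A = g 0 ^ 2 + g 1 ^ 2 + g 2 ^ 2 + g 3 ^ 2 + g 4 ^ 2 := by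
      rw [hA]; simp [Finset.sum_range_succ]
    norm_num at k1 k2 ⊢
    rw [hA']
    nlinarith [sq_nonneg (g 1), sq_nonneg (g 2), sq_nonneg (g 3)]
  · have p2 := sum_range_pair_le (m := k + 3 + 1) g (i := 2) (j := k + 1) (by omega) (by omega)
      (by omega) (by omega) (by omega)
    rw [← hA, Nat.add_sub_cancel] at p2
    nlinarith

end Eigenvector

/-! ### Monotonicity of the gap on [n]. -/

/-- The sequence obtained from `f` by repeating the `k`-th entry. -/
def repeatEntry (f : ℕ → ℝ) (k i : ℕ) : ℝ :=
  if i ≤ k then f i else f (i - 1)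

theorem sum_range_succ_insert {m k : ℕ} (hk : k ≤ m) (u a : ℕ → ℝ)
    (h1 : ∀ p, p < k → u p = a p) (h2 : ∀ p, k ≤ p → u (p + 1) = a p) :
    ∑ p ∈ Finset.range (m + 1), u p = u k + ∑ p ∈ Finset.range m, a p := by
  induction m with
  | zero =>
    have : k = 0 := by omega
    simp [this]
  | succ m ih =>
    by_cases h : k = m + 1
    · subst h
      rw [Finset.sum_range_succ, add_comm]
      congr 1
      exact Finset.sum_congr rfl fun p hp => h1 p (Finset.mem_range.mp hp)
    · rw [Finset.sum_range_succ, ih (by omega), h2 m (by omega), Finset.sum_range_succ a]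
      ring

theorem sum_range_repeatEntry {m k : ℕ} (hk : k ≤ m) (φ : ℝ → ℝ) (f : ℕ → ℝ) :
    ∑ i ∈ Finset.range (m + 2), φ (repeatEntry f k i) =
      φ (f k) + ∑ i ∈ Finset.range (m + 1), φ (f i) := by
  rw [sum_range_succ_insert (k := k) (by omega) _ (fun i => φ (f i))]
  · simp [repeatEntry]
  · intro p hp
    simp [repeatEntry, hp.le]
  · intro p hp
    simp [repeatEntry, show ¬ p + 1 ≤ k by omega]

theorem sum_increments_repeatEntry {m k : ℕ} (hk : k ≤ m) (f : ℕ → ℝ) :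
    ∑ p ∈ Finset.range (m + 1), (repeatEntry f k (p + 1) - repeatEntry f k p) ^ 2 =
      ∑ p ∈ Finset.range m, (f (p + 1) - f p) ^ 2 := by
  rw [sum_range_succ_insert hk _ (fun p => (f (p + 1) - f p) ^ 2)]
  · simp [repeatEntry]
  · intro p hp
    simp [repeatEntry, hp.le, show p + 1 ≤ k by omega]
  · intro p hp
    rw [repeatEntry, repeatEntry, if_neg (by omega), if_neg (by omega)]
    rfl

theorem sum_sum_double_increments_repeatEntry (j : ℕ) (f : ℕ → ℝ) :
    ∑ k ∈ Finset.range (j + 2), ∑ p ∈ Finset.range (j + 1),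
        (repeatEntry f k (p + 2) - repeatEntry f k p) ^ 2 =
      2 * ∑ p ∈ Finset.range (j + 1), (f (p + 1) - f p) ^ 2 +
        (j + 1) * ∑ p ∈ Finset.range j, (f (p + 2) - f p) ^ 2 := by
  set b : ℕ → ℝ := fun p => (f (p + 2) - f p) ^ 2 with hb
  -- For fixed p, the p values k < p shift the window and give `b (p - 1)`; k = p and k = p + 1
  -- shorten it to a single increment; the remaining j - p values leave it unchanged. The truncated
  -- index at p = 0 has coefficient 0.
  have hcol : ∀ p ∈ Finset.range (j + 1), ∑ k ∈ Finset.range (j + 2),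
      (repeatEntry f k (p + 2) - repeatEntry f k p) ^ 2 =
      p * b (p - 1) + 2 * (f (p + 1) - f p) ^ 2 + (j - p) * b p := by
    intro p hp
    have hp' := Finset.mem_range.mp hp
    obtain ⟨q, rfl⟩ : ∃ q, j = p + q := ⟨j - p, by omega⟩
    rw [show p + q + 2 = p + 2 + q by ring, Finset.sum_range_add, Finset.sum_range_succ,
      Finset.sum_range_succ]
    have t1 : ∀ k ∈ Finset.range p, (repeatEntry f k (p + 2) - repeatEntry f k p) ^ 2 =
        b (p - 1) := by
      intro k hk
      have := Finset.mem_range.mp hk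
      rw [repeatEntry, repeatEntry, if_neg (by omega), if_neg (by omega)]
      simp only [hb]
      rw [show p + 2 - 1 = p - 1 + 2 by omega]
    have t2 : ∀ k ∈ Finset.range q,
        (repeatEntry f (p + 2 + k) (p + 2) - repeatEntry f (p + 2 + k) p) ^ 2 = b p := by
      intro k _
      rw [repeatEntry, repeatEntry, if_pos (by omega), if_pos (by omega)]
    rw [Finset.sum_congr rfl t1, Finset.sum_congr rfl t2]
    simp [repeatEntry]
    ring
  rw [Finset.sum_comm, Finset.sum_congr rfl hcol, Finset.sum_add_distrib, Finset.sum_add_distrib,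
    ← Finset.mul_sum, Finset.sum_range_succ', Finset.sum_range_succ (fun p => ((j : ℝ) - p) * b p)]
  simp only [Nat.add_sub_cancel, Nat.cast_zero, zero_mul, add_zero, sub_self, Finset.mul_sum]
  have : ∑ p ∈ Finset.range j, ((j : ℝ) + 1) * b p = ∑ p ∈ Finset.range j, ((p + 1 : ℕ) : ℝ) * b p +
      ∑ p ∈ Finset.range j, ((j : ℝ) - p) * b p := by
    rw [← Finset.sum_add_distrib]
    refine Finset.sum_congr rfl fun p _ => ?_
    push_cast
    ring
  rw [this]
  ring

/-- Each repetition of an entry of an eigenvector for γ is a test function for γ'. Summing the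
resulting inequalities over all positions expresses everything in A, S, the end squares and the norm
F. -/
theorem spectralGap_succ_le {j : ℕ} (hj : 3 ≤ j) {γ γ' : ℝ}
    (h : IsSpectralGap (Fin (j + 2)) (twoNonCuts (j + 2)) γ)
    (h' : IsSpectralGap (Fin (j + 3)) (twoNonCuts (j + 3)) γ') (hγ : γ ≤ 4) : γ' ≤ γ := by
  obtain ⟨v, hv, hv0, hvγ⟩ := h.eigen
  set f : ℕ → ℝ := fun i => if hi : i < j + 2 then v ⟨i, hi⟩ else 0 with hf
  have hfv : ∀ i : Fin (j + 2), f i = v i := fun i => by simp [hf]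
  have hB := pathBilin_eq_of_eigenvector (m := j + 1) (γ := γ) (f := f)
    (by intro i; simp only [hfv]; exact hvγ i)
  set g : ℕ → ℝ := fun p => f (p + 1) - f p with hg
  have c1 := increments_correlation hB hγ g (fun _ => rfl)
  have c2 := extreme_increments_le hj hB hγ g (fun _ => rfl)
  set A := ∑ p ∈ Finset.range (j + 1), g p ^ 2 with hA
  set S := ∑ p ∈ Finset.range j, g p * g (p + 1) with hS
  set D := ∑ p ∈ Finset.range j, (f (p + 2) - f p) ^ 2 with hD
  set F := ∑ i ∈ Finset.range (j + 2), f i ^ 2 with hF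
  have hA0 : 0 ≤ A := Finset.sum_nonneg fun _ _ => sq_nonneg _
  have hj' : (3 : ℝ) ≤ j := by exact_mod_cast hj
  have hDA : D = 2 * A - (g 0 ^ 2 + g j ^ 2) + 2 * S := by
    have t1 : A = ∑ p ∈ Finset.range j, g p ^ 2 + g j ^ 2 := Finset.sum_range_succ _ _
    have t2 : A = ∑ p ∈ Finset.range j, g (p + 1) ^ 2 + g 0 ^ 2 := Finset.sum_range_succ' _ _
    have t3 : D = ∑ p ∈ Finset.range j, g p ^ 2 + ∑ p ∈ Finset.range j, g (p + 1) ^ 2 + 2 * S := by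
      rw [hD, hS, Finset.mul_sum, ← Finset.sum_add_distrib, ← Finset.sum_add_distrib]
      refine Finset.sum_congr rfl fun p _ => ?_
      simp only [hg]
      ring
    linarith
  have hFv : F = ∑ i, v i ^ 2 := by
    rw [hF, ← Fin.sum_univ_eq_sum_range (fun i => f i ^ 2)]
    simp only [hfv]
  have hF0 : 0 < F := by rw [hFv]; exact sum_sq_pos hv
  have hQ : (j : ℝ) * A + 2 * D = γ * F := by
    have := hB f
    simp only [pathBilin, ← sq] at this
    rw [show j + 1 + 1 - 1 = j + 1 from rfl, show j + 1 + 1 - 2 = j from rfl] at this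
    rw [← this]
    push_cast
    ring
  have hsum0 : ∑ i ∈ Finset.range (j + 2), f i = 0 := by
    rw [← Fin.sum_univ_eq_sum_range]
    simp only [hfv, hv0]
  have hk : ∀ k ∈ Finset.range (j + 2), γ' * (f k ^ 2 + F - f k ^ 2 / (j + 3)) ≤
      (j + 1) * A + 2 * ∑ p ∈ Finset.range (j + 1),
        (repeatEntry f k (p + 2) - repeatEntry f k p) ^ 2 := by
    intro k hk
    have hk' := Finset.mem_range.mp hk
    have h1 := h'.mul_variance_le (fun i : Fin (j + 3) => repeatEntry f k i)
    rw [actionEnergy_twoNonCuts (j + 2) (repeatEntry f k), pathForm,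
      Fin.sum_univ_eq_sum_range (fun i => repeatEntry f k i ^ 2),
      Fin.sum_univ_eq_sum_range (fun i => repeatEntry f k i), Fintype.card_fin] at h1
    rw [show j + 3 = j + 1 + 2 from rfl,
      sum_range_repeatEntry (show k ≤ j + 1 by omega) (fun x => x ^ 2) f,
      sum_range_repeatEntry (show k ≤ j + 1 by omega) (fun x => x) f, hsum0, add_zero] at h1
    rw [show j + 2 + 1 - 1 = j + 1 + 1 from rfl, show j + 2 + 1 - 2 = j + 1 from rfl,
      sum_increments_repeatEntry (show k ≤ j + 1 by omega)] at h1
    push_cast at h1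
    have e1 : (j : ℝ) + 1 + 2 = j + 3 := by ring
    have e2 : (j : ℝ) + 3 - 2 = j + 1 := by ring
    rw [e1, e2] at h1
    exact h1
  have hsum := Finset.sum_le_sum hk
  rw [← Finset.mul_sum, Finset.sum_sub_distrib, Finset.sum_add_distrib, ← Finset.sum_div, ← hF,
    Finset.sum_add_distrib, ← Finset.mul_sum (f := fun k => ∑ p ∈ Finset.range (j + 1),
      (repeatEntry f k (p + 2) - repeatEntry f k p) ^ 2), sum_sum_double_increments_repeatEntry] at hsum
  simp only [Finset.sum_const, Finset.card_range, nsmul_eq_mul] at hsum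
  push_cast at hsum
  change γ' * (F + ((j : ℝ) + 2) * F - F / (j + 3)) ≤
    (j + 2) * ((j + 1) * A) + 2 * (2 * A + (j + 1) * D) at hsum
  have hl : γ' * (F + ((j : ℝ) + 2) * F - F / (j + 3)) * (j + 3) =
      γ' * (((j : ℝ) + 2) * (j + 4) * F) := by
    field_simp
    ring
  have hmul := mul_le_mul_of_nonneg_right hsum (by positivity : (0 : ℝ) ≤ j + 3)
  rw [hl] at hmul
  set e := g 0 ^ 2 + g j ^ 2 with he
  -- This is what remains of the comparison after inserting `hDA` and `hQ` and clearing the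
  -- denominator j + 3.
  have main : 0 ≤ ((j : ℝ) + 2) * A + (8 * (j + 2) + 4) * S - (4 * (j + 2) + 2) * e := by
    have h1 : (0 : ℝ) < 2 * (j + 2) - 4 := by linarith
    have h2 := mul_le_mul_of_nonneg_left c1 (by positivity : (0 : ℝ) ≤ 8 * ((j : ℝ) + 2) + 4)
    have h3 : 0 ≤ (8 * ((j : ℝ) + 2) ^ 2 - 4 * (j + 2) - 4) * (5 * A - 8 * e) := by
      apply mul_nonneg
      · nlinarith
      · linarith
    -- The coefficient of A left after S is bounded by `c1` and e by `c2`. With n = j + 2 it equals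
    -- 8 at n = 5 and is negative at n = 4, which is why j ≥ 3 is required.
    have h4 : 0 ≤ (13 * ((j : ℝ) + 2) ^ 2 - 57.5 * (j + 2) - 29.5) * A := by
      apply mul_nonneg _ hA0
      nlinarith
    have h5 : 0 ≤ (2 * ((j : ℝ) + 2) - 4) *
      (((j : ℝ) + 2) * A + (8 * (j + 2) + 4) * S - (4 * (j + 2) + 2) * e) := by
      nlinarith
    exact nonneg_of_mul_nonneg_right h5 h1
  have hfin : γ' * (((j : ℝ) + 2) * (j + 4) * F) ≤ γ * (((j : ℝ) + 2) * (j + 4) * F) := by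
    refine hmul.trans ?_
    have : γ * (((j : ℝ) + 2) * (j + 4) * F) = ((j : ℝ) + 2) * (j + 4) * (j * A + 2 * D) := by
      rw [hQ]; ring
    rw [this, hDA]
    nlinarith
  exact le_of_mul_le_mul_right hfin (by positivity)

/-! ### Passing from the smaller symmetric group to the larger one. -/

theorem actionEnergy_mono {G X : Type*} [Group G] [MulAction G X] [Fintype X] {T T' : Finset G}
    (h : T ⊆ T') (f : X → ℝ) : actionEnergy T f ≤ actionEnergy T' f := by
  unfold actionEnergy
  gcongr

theorem actionEnergy_union {G X : Type*} [Group G] [DecidableEq G] [MulAction G X] [Fintype X]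
    {T T' : Finset G} (h : Disjoint T T') (f : X → ℝ) :
    actionEnergy (T ∪ T') f = actionEnergy T f + actionEnergy T' f := by
  unfold actionEnergy
  rw [Finset.sum_union h, mul_add]

/-- The copy of `T` in the stabiliser of the point missed by `e`. -/
noncomputable def embedPerms {n : ℕ} (e : Fin n ↪ Fin (n + 1)) (T : Finset (Equiv.Perm (Fin n))) :
    Finset (Equiv.Perm (Fin (n + 1))) :=
  T.map ⟨Equiv.Perm.viaEmbeddingHom e, Equiv.Perm.viaEmbeddingHom_injective e⟩

/-- A lower bound for the Dirichlet form on `S_n` gives one on `S_{n+1}` for functions with sum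
zero on the cosets of `S_n`. -/
theorem mul_sum_sq_le_actionEnergy_embedPerms {n : ℕ} {e : Fin n ↪ Fin (n + 1)} {b : Fin (n + 1)}
    (hb : ∀ x, x ∈ Set.range e ↔ x ≠ b) {T : Finset (Equiv.Perm (Fin n))} {γ : ℝ}
    (hγ : ∀ F : Equiv.Perm (Fin n) → ℝ, ∑ g, F g = 0 → γ * ∑ g, F g ^ 2 ≤ actionEnergy T F)
    {F : Equiv.Perm (Fin (n + 1)) → ℝ} (hF : ∀ a, ∑ g with g a = b, F g = 0) :
    γ * ∑ g, F g ^ 2 ≤ actionEnergy (embedPerms e T) F := by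
  set φ := Equiv.Perm.viaEmbeddingHom e with hφ
  have hφinj : Function.Injective φ := Equiv.Perm.viaEmbeddingHom_injective e
  have hφb : ∀ h, φ h b = b := fun h => viaEmbeddingHom_apply_of_notMem e h (by rw [hb]; simp)
  have h0 : ∀ g, ∑ h, F (φ h * g) = 0 := by
    intro g
    rw [← hF (g⁻¹ b)]
    refine Finset.sum_bij (fun h _ => φ h * g) ?_ ?_ ?_ (fun _ _ => rfl)
    · intro h _
      simp [hφb]
    · intro h _ h' _ heq
      exact hφinj (mul_right_cancel heq)
    · intro k hk
      obtain ⟨h, hh⟩ := exists_viaEmbeddingHom_eq hb (g := k * g⁻¹)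
        (by simpa using (Finset.mem_filter.mp hk).2)
      refine ⟨h, Finset.mem_univ _, ?_⟩
      rw [hφ, hh]
      simp
  -- Apply the bound on every translate of the orbit and sum over g; each term of the larger group
  -- is then counted once for each element of the smaller one.
  have h1 := fun g => hγ (fun h => F (φ h * g)) (h0 g)
  have h2 := Finset.sum_le_sum fun g (_ : g ∈ Finset.univ) => h1 g
  have htrans : ∀ (ψ : Equiv.Perm (Fin (n + 1)) → ℝ), ∑ g, ∑ h, ψ (φ h * g) =
      Fintype.card (Equiv.Perm (Fin n)) * ∑ g, ψ g := by
    intro ψ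
    rw [Finset.sum_comm]
    have : ∀ h, ∑ g, ψ (φ h * g) = ∑ g, ψ g := fun h => Equiv.sum_comp (Equiv.mulLeft (φ h)) ψ
    simp only [this]
    simp
  rw [← Finset.mul_sum, htrans (fun g => F g ^ 2)] at h2
  have h3 : ∑ g, actionEnergy T (fun h => F (φ h * g)) =
      Fintype.card (Equiv.Perm (Fin n)) * actionEnergy (embedPerms e T) F := by
    simp only [actionEnergy, embedPerms, Finset.sum_map, Function.Embedding.coeFn_mk,
      ← Finset.mul_sum]
    rw [Finset.sum_comm]
    have : ∀ σ, ∑ g, ∑ h, (F (φ (σ • h) * g) - F (φ h * g)) ^ 2 =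
        Fintype.card (Equiv.Perm (Fin n)) * ∑ g, (F (φ σ • g) - F g) ^ 2 := by
      intro σ
      rw [← htrans (fun g => (F (φ σ • g) - F g) ^ 2)]
      simp only [smul_eq_mul, map_mul, mul_assoc]
    simp only [this, ← Finset.mul_sum]
    ring
  rw [h3] at h2
  have hc : (0 : ℝ) < Fintype.card (Equiv.Perm (Fin n)) := by
    exact_mod_cast Fintype.card_pos
  refine le_of_mul_le_mul_left ?_ hc
  linarith

theorem mem_range_castSuccEmb {n : ℕ} (x : Fin (n + 1)) :
    x ∈ Set.range (Fin.castSuccEmb (n := n)) ↔ x ≠ Fin.last n := by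
  rw [Fin.coe_castSuccEmb, Set.mem_range, Fin.exists_castSucc_eq]

theorem embedPerms_castSucc_subset (n : ℕ) :
    embedPerms Fin.castSuccEmb (twoNonCuts n) ⊆ twoNonCuts (n + 1) := by
  intro σ hσ
  obtain ⟨τ, hτ, rfl⟩ := Finset.mem_map.mp hσ
  rw [mem_twoNonCuts] at *
  exact (congrArg Finset.card (nonCuts_viaEmbeddingHom_castSucc τ)).trans
    ((Finset.card_map _).trans hτ)

theorem embedPerms_succ_subset (n : ℕ) :
    embedPerms (Fin.succEmb n) (twoNonCuts n) ⊆ twoNonCuts (n + 1) := by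
  intro σ hσ
  obtain ⟨τ, hτ, rfl⟩ := Finset.mem_map.mp hσ
  rw [mem_twoNonCuts] at *
  exact (congrArg Finset.card (nonCuts_viaEmbeddingHom_succ τ)).trans
    ((Finset.card_map _).trans hτ)

/-! ### The small cases n = 3, 4, 5. -/

/-- The non-cuts of one family lie in {0, 1} and those of the other in {1, 2}, so a common element
would have at most one non-cut. -/
theorem disjoint_embedPerms_three :
    Disjoint (embedPerms Fin.castSuccEmb (twoNonCuts 3))
      (embedPerms (Fin.succEmb 3) (twoNonCuts 3)) := by
  rw [Finset.disjoint_left]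
  intro σ h1 h2
  have hcard := mem_twoNonCuts.mp (embedPerms_castSucc_subset 3 h1)
  obtain ⟨τ, -, rfl⟩ := Finset.mem_map.mp h1
  obtain ⟨τ', -, h⟩ := Finset.mem_map.mp h2
  have e1 := nonCuts_viaEmbeddingHom_castSucc τ
  have e2 := nonCuts_viaEmbeddingHom_succ τ'
  change Equiv.Perm.viaEmbeddingHom (Fin.succEmb 3) τ' =
    Equiv.Perm.viaEmbeddingHom Fin.castSuccEmb τ at h
  change (nonCuts (Equiv.Perm.viaEmbeddingHom Fin.castSuccEmb τ)).card = 2 at hcard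
  rw [h] at e2
  have hsub : nonCuts (Equiv.Perm.viaEmbeddingHom Fin.castSuccEmb τ) ⊆ {1} := by
    intro x hx
    have hx2 := hx
    rw [e1] at hx
    rw [e2] at hx2
    obtain ⟨y, hy, rfl⟩ := Finset.mem_map.mp hx
    obtain ⟨z, -, hz⟩ := Finset.mem_map.mp hx2
    have hy2 : y ≠ Fin.last 2 := fun h => last_notMem_nonCuts τ (h ▸ hy)
    simp only [Finset.mem_singleton, Fin.coe_castSuccEmb, Fin.coe_succEmb, Fin.ext_iff, Ne] at *
    simp at *
    omega
  have := Finset.card_le_card hsub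
  rw [hcard] at this
  simp at this

/-- The Cayley graph is the triangular prism, with gap 2 attained by the sign character. The
certificate splits F into its means on the two triangles and the deviations from them; the squares
are the deviations within the triangles and across the matching. -/
theorem two_mul_sum_sq_le_actionEnergy_three (F : Equiv.Perm (Fin 3) → ℝ) (hF : ∑ g, F g = 0) :
    2 * ∑ g, F g ^ 2 ≤ actionEnergy (twoNonCuts 3) F := by
  have hT : twoNonCuts 3 = {Equiv.swap 0 2, Equiv.swap 0 1 * Equiv.swap 1 2,
    Equiv.swap 1 2 * Equiv.swap 0 1} := by decide
  have hU : ∀ ψ : Equiv.Perm (Fin 3) → ℝ, ∑ g, ψ g = ψ 1 + ψ (Equiv.swap 0 1 * Equiv.swap 1 2) +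
      ψ (Equiv.swap 1 2 * Equiv.swap 0 1) + ψ (Equiv.swap 0 2) + ψ (Equiv.swap 0 1) +
      ψ (Equiv.swap 1 2) := by
    intro ψ
    have : (Finset.univ : Finset (Equiv.Perm (Fin 3))) = {1, Equiv.swap 0 1 * Equiv.swap 1 2,
      Equiv.swap 1 2 * Equiv.swap 0 1, Equiv.swap 0 2, Equiv.swap 0 1, Equiv.swap 1 2} := by decide
    rw [this, Finset.sum_insert (by decide), Finset.sum_insert (by decide),
      Finset.sum_insert (by decide), Finset.sum_insert (by decide), Finset.sum_insert (by decide),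
      Finset.sum_singleton]
    ring
  rw [actionEnergy, hT, Finset.sum_insert (by decide), Finset.sum_insert (by decide),
    Finset.sum_singleton]
  simp only [hU, smul_eq_mul] at *
  generalize ha : (Equiv.swap 0 1 * Equiv.swap 1 2 : Equiv.Perm (Fin 3)) = a at *
  generalize hb : (Equiv.swap 1 2 * Equiv.swap 0 1 : Equiv.Perm (Fin 3)) = b at *
  generalize ht : (Equiv.swap 0 2 : Equiv.Perm (Fin 3)) = t at *
  generalize hs : (Equiv.swap 0 1 : Equiv.Perm (Fin 3)) = s at *
  generalize hr : (Equiv.swap 1 2 : Equiv.Perm (Fin 3)) = r at *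
  have m1 : a * a = b := by subst_vars; decide
  have m2 : a * b = 1 := by subst_vars; decide
  have m3 : b * a = 1 := by subst_vars; decide
  have m4 : b * b = a := by subst_vars; decide
  have m5 : t * t = 1 := by subst_vars; decide
  have m6 : t * a = s := by subst_vars; decide
  have m7 : t * b = r := by subst_vars; decide
  have m8 : t * s = a := by subst_vars; decide
  have m9 : t * r = b := by subst_vars; decide
  have n1 : a * t = r := by subst_vars; decide
  have n2 : a * s = t := by subst_vars; decide
  have n3 : a * r = s := by subst_vars; decide
  have n4 : b * t = s := by subst_vars; decide
  have n5 : b * s = r := by subst_vars; decide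
  have n6 : b * r = t := by subst_vars; decide
  simp only [mul_one, m1, m2, m3, m4, m5, m6, m7, m8, m9, n1, n2, n3, n4, n5, n6]
  generalize F 1 = x1 at *
  generalize F a = x2 at *
  generalize F b = x3 at *
  generalize F t = y1 at *
  generalize F s = y3 at *
  generalize F r = y2 at *
  obtain rfl : y1 = -(x1 + x2 + x3 + y2 + y3) := by linarith
  linarith [sq_nonneg (x1 + (x1 + x2 + x3 + y2 + y3) - 2 / 3 * (x1 + x2 + x3)),
    sq_nonneg (x2 - y3 - 2 / 3 * (x1 + x2 + x3)), sq_nonneg (x3 - y2 - 2 / 3 * (x1 + x2 + x3)),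
    sq_nonneg (x1 - (x1 + x2 + x3) / 3), sq_nonneg (x2 - (x1 + x2 + x3) / 3),
    sq_nonneg (x3 - (x1 + x2 + x3) / 3), sq_nonneg (y2 + (x1 + x2 + x3) / 3),
    sq_nonneg (y3 + (x1 + x2 + x3) / 3),
    sq_nonneg (x1 + x2 + x3 + y2 + y3 - (x1 + x2 + x3) / 3)]

theorem spectralGap_four_le {γ : ℝ} (h : IsSpectralGap (Fin 4) (twoNonCuts 4) γ) : γ ≤ 4 := by
  have h1 := h.mul_variance_le
    (fun i : Fin 4 => (fun i : ℕ => if i = 0 then (1 : ℝ) else if i = 3 then -1 else 0) i)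
  rw [actionEnergy_twoNonCuts 3 (fun i : ℕ => if i = 0 then (1 : ℝ) else if i = 3 then -1 else 0)]
    at h1
  simp only [Fin.sum_univ_four] at h1
  simp [pathForm, Finset.sum_range_succ] at h1
  norm_num at h1
  linarith

theorem four_le_spectralGap_four {γ : ℝ} (h : IsSpectralGap (Fin 4) (twoNonCuts 4) γ) :
    4 ≤ γ := by
  obtain ⟨v, hv, hv0, hvγ⟩ := h.eigen
  have h1 := energy_eigenvector hvγ
  have h2 := actionEnergy_twoNonCuts 3 (fun i => if hi : i < 4 then v ⟨i, hi⟩ else 0)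
  have h3 : (fun i : Fin (3 + 1) => if hi : (i : ℕ) < 4 then v ⟨i, hi⟩ else 0) = v := by
    funext i
    simp
  rw [h3, h1] at h2
  have hpos := sum_sq_pos hv
  refine le_of_mul_le_mul_right ?_ hpos
  rw [h2]
  simp only [Fin.sum_univ_four] at hv0 ⊢
  simp [pathForm, Finset.sum_range_succ]
  generalize v 0 = x at *
  generalize v 1 = y at *
  generalize v 2 = z at *
  change x + y + z + v 3 = 0 at hv0
  change _ ≤ _ * ((y - x) ^ 2 + (z - y) ^ 2 + (v 3 - z) ^ 2) + 2 * ((z - x) ^ 2 + (v 3 - y) ^ 2)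
  obtain h4 : v 3 = -(x + y + z) := by linarith
  rw [h4]
  -- For n = 4 the form is twice that of the complete graph without the edge joining the end points
  -- x and w. On sum-zero vectors its excess over 4 times the squared norm is 2(x + w)² + 4y² + 4z².
  nlinarith [sq_nonneg (x - (x + y + z)), sq_nonneg y, sq_nonneg z]

/-- The vector (5, 2, 0, -2, -5) has energy 210 and squared norm 58. -/
theorem spectralGap_five_le {γ : ℝ} (h : IsSpectralGap (Fin 5) (twoNonCuts 5) γ) : γ ≤ 4 := by
  have h1 := h.mul_variance_le
    (fun i : Fin 5 => (fun i : ℕ => if i = 0 then (5 : ℝ) else if i = 1 then 2 else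
      if i = 3 then -2 else if i = 4 then -5 else 0) i)
  rw [actionEnergy_twoNonCuts 4 (fun i : ℕ => if i = 0 then (5 : ℝ) else if i = 1 then 2 else
      if i = 3 then -2 else if i = 4 then -5 else 0)] at h1
  simp [pathForm, Finset.sum_range_succ, Fin.sum_univ_succ] at h1
  norm_num at h1
  linarith

/-! ### Induction on n for the Cayley graph. -/

theorem nontrivial_perm_fin {n : ℕ} (hn : 2 ≤ n) : Nontrivial (Equiv.Perm (Fin n)) := by
  have : Nontrivial (Fin n) := Fin.nontrivial_iff_two_le.mpr hn
  infer_instance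

/-- Dichotomy for an eigenfunction E of the gap on the group: either all its fibre sums vanish and
`hU` applies, or for some a the function c ↦ Σ_{g a = c} E g is a nonzero eigenvector on the points
with the same eigenvalue. -/
theorem mul_sum_sq_le_of_isSpectralGap {n : ℕ} (hn : 2 ≤ n) {T : Finset (Equiv.Perm (Fin n))}
    (hT : ∀ σ ∈ T, σ⁻¹ ∈ T) {γ : ℝ} (h : IsSpectralGap (Fin n) T γ)
    (hU : ∀ F : Equiv.Perm (Fin n) → ℝ, (∀ a b, ∑ g with g a = b, F g = 0) →
      γ * ∑ g, F g ^ 2 ≤ actionEnergy T F)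
    (F : Equiv.Perm (Fin n) → ℝ) (hF : ∑ g, F g = 0) :
    γ * ∑ g, F g ^ 2 ≤ actionEnergy T F := by
  have := nontrivial_perm_fin hn
  obtain ⟨γ', h'⟩ := exists_isSpectralGap (X := Equiv.Perm (Fin n)) hT
  refine le_trans (mul_le_mul_of_nonneg_right ?_ (Finset.sum_nonneg fun _ _ => sq_nonneg _))
    (h'.bound F hF)
  obtain ⟨E, hE, hE0, hEγ⟩ := h'.eigen
  by_cases hall : ∀ a b, ∑ g with g a = b, E g = 0
  · have := hU E hall
    rw [energy_eigenvector hEγ] at this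
    exact le_of_mul_le_mul_right this (sum_sq_pos hE)
  · push Not at hall
    obtain ⟨a, b, hab⟩ := hall
    refine h.le_of_eigenvector (v := fun c => ∑ g with g a = c, E g) ?_ ?_ ?_
    · intro h0
      exact hab (congrFun h0 b)
    · rw [← hE0]
      exact Finset.sum_fiberwise Finset.univ (fun g : Equiv.Perm (Fin n) => g a) E
    · intro c
      have hshift : ∀ σ : Equiv.Perm (Fin n), ∑ g with g a = σ • c, E g =
          ∑ g with g a = c, E (σ • g) := by
        intro σ
        simp only [Finset.sum_filter]
        rw [← Equiv.sum_comp (Equiv.mulLeft σ)]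
        simp [Equiv.Perm.smul_def]
      simp only [hshift, ← Finset.sum_sub_distrib]
      rw [Finset.sum_comm, Finset.mul_sum]
      exact Finset.sum_congr rfl fun g _ => hEγ g

theorem mul_sum_sq_le_actionEnergy_four {γ : ℝ} (h : IsSpectralGap (Fin 4) (twoNonCuts 4) γ)
    (F : Equiv.Perm (Fin 4) → ℝ) (hF : ∑ g, F g = 0) :
    γ * ∑ g, F g ^ 2 ≤ actionEnergy (twoNonCuts 4) F := by
  refine mul_sum_sq_le_of_isSpectralGap (by norm_num) inv_mem_twoNonCuts h ?_ F hF
  intro F hF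
  have h1 := mul_sum_sq_le_actionEnergy_embedPerms (e := Fin.castSuccEmb) (b := Fin.last 3)
    mem_range_castSuccEmb two_mul_sum_sq_le_actionEnergy_three
    (fun a => hF a _)
  have h2 := mul_sum_sq_le_actionEnergy_embedPerms (e := Fin.succEmb 3) (b := 0)
    (by intro x; simp) two_mul_sum_sq_le_actionEnergy_three
    (fun a => hF a _)
  have h3 := actionEnergy_mono (Finset.union_subset (embedPerms_castSucc_subset 3)
    (embedPerms_succ_subset 3)) F
  rw [actionEnergy_union disjoint_embedPerms_three] at h3
  have h4 : γ * ∑ g, F g ^ 2 ≤ 4 * ∑ g, F g ^ 2 :=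
    mul_le_mul_of_nonneg_right (spectralGap_four_le h) (Finset.sum_nonneg fun _ _ => sq_nonneg _)
  linarith

theorem exists_isSpectralGap_fin (n : ℕ) : ∃ γ, IsSpectralGap (Fin (n + 2)) (twoNonCuts (n + 2)) γ :=
  exists_isSpectralGap inv_mem_twoNonCuts

theorem mul_sum_sq_le_actionEnergy_succ {n : ℕ} {γ γ' : ℝ} (hγ : γ' ≤ γ)
    (hn : ∀ F : Equiv.Perm (Fin (n + 1)) → ℝ, ∑ g, F g = 0 →
      γ * ∑ g, F g ^ 2 ≤ actionEnergy (twoNonCuts (n + 1)) F)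
    (h' : IsSpectralGap (Fin (n + 2)) (twoNonCuts (n + 2)) γ')
    (F : Equiv.Perm (Fin (n + 2)) → ℝ) (hF : ∑ g, F g = 0) :
    γ' * ∑ g, F g ^ 2 ≤ actionEnergy (twoNonCuts (n + 2)) F := by
  refine mul_sum_sq_le_of_isSpectralGap (by omega) inv_mem_twoNonCuts h' ?_ F hF
  intro F hF
  have h1 := mul_sum_sq_le_actionEnergy_embedPerms (e := Fin.castSuccEmb) (b := Fin.last (n + 1))
    mem_range_castSuccEmb hn (fun a => hF a _)
  have h3 := actionEnergy_mono (embedPerms_castSucc_subset (n + 1)) F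
  have h4 : γ' * ∑ g, F g ^ 2 ≤ γ * ∑ g, F g ^ 2 :=
    mul_le_mul_of_nonneg_right hγ (Finset.sum_nonneg fun _ _ => sq_nonneg _)
  linarith

/-- The bound γ ≤ 4 is carried along because `spectralGap_succ_le` needs it. The step from 4 to 5 is
outside the range of that lemma and is settled by the numerical bounds γ_5 ≤ 4 ≤ γ_4. -/
theorem mul_sum_sq_le_actionEnergy_twoNonCuts (k : ℕ) : ∀ γ : ℝ,
    IsSpectralGap (Fin (k + 5)) (twoNonCuts (k + 5)) γ →
    γ ≤ 4 ∧ ∀ F : Equiv.Perm (Fin (k + 5)) → ℝ, ∑ g, F g = 0 →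
      γ * ∑ g, F g ^ 2 ≤ actionEnergy (twoNonCuts (k + 5)) F := by
  induction k with
  | zero =>
    intro γ h
    obtain ⟨γ₄, h4⟩ := exists_isSpectralGap_fin 2
    exact ⟨spectralGap_five_le h, fun F hF => mul_sum_sq_le_actionEnergy_succ
      ((spectralGap_five_le h).trans (four_le_spectralGap_four h4))
      (mul_sum_sq_le_actionEnergy_four h4) h F hF⟩
  | succ k ih =>
    intro γ' h'
    obtain ⟨γ, h⟩ := exists_isSpectralGap_fin (k + 3)
    have hle : γ' ≤ γ := spectralGap_succ_le (j := k + 3) (by omega) h h' (ih γ h).1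
    exact ⟨hle.trans (ih γ h).1,
      fun F hF => mul_sum_sq_le_actionEnergy_succ hle (ih γ h).2 h' F hF⟩

/-- The spectral gap of the Schreier graph is that of the Cayley graph. -/
theorem IsSpectralGap.perm {n : ℕ} (hn : 4 ≤ n) {γ : ℝ}
    (h : IsSpectralGap (Fin n) (twoNonCuts n) γ) :
    IsSpectralGap (Equiv.Perm (Fin n)) (twoNonCuts n) γ := by
  refine ⟨?_, ?_⟩
  · obtain ⟨v, hv, hv0, hvγ⟩ := h.eigen
    set o : Fin n := ⟨0, by omega⟩
    refine ⟨fun g => v (g o), ?_, ?_, fun g => hvγ (g o)⟩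
    · obtain ⟨x, hx⟩ := Function.ne_iff.mp hv
      intro h0
      apply hx
      have := congrFun h0 (Equiv.swap o x)
      simpa using this
    · have h1 : ∀ i : Fin n, ∑ g : Equiv.Perm (Fin n), v (g i) = ∑ g : Equiv.Perm (Fin n), v (g o) := by
        intro i
        rw [← Equiv.sum_comp (Equiv.mulRight (Equiv.swap o i))]
        simp
      have h2 : ∑ i : Fin n, ∑ g : Equiv.Perm (Fin n), v (g i) = 0 := by
        rw [Finset.sum_comm]
        refine Finset.sum_eq_zero fun g _ => ?_
        rw [← hv0]
        exact Equiv.sum_comp g v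
      simp only [h1, Finset.sum_const, Finset.card_univ, Fintype.card_fin, smul_eq_zero] at h2
      exact h2.resolve_left (by omega)
  · rcases Nat.lt_or_ge 4 n with h5 | h4
    · obtain ⟨k, rfl⟩ : ∃ k, n = k + 5 := ⟨n - 5, by omega⟩
      exact (mul_sum_sq_le_actionEnergy_twoNonCuts k γ h).2
    · obtain rfl : n = 4 := by omega
      exact mul_sum_sq_le_actionEnergy_four h

/-! ### Assembly. -/

theorem theorem1p1 (n : ℕ) (hn : 4 ≤ n) :
    Nonempty (fullFlagJohnsonGraph n 2 ≃g
      cayleyGraph (reducibleSet n 2 (by omega) (by omega))) ∧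
    HasAldousProperty (reducibleSet n 2 (by omega) (by omega)) ∧
    IsQuotientMatrix (cayleyGraph (reducibleSet n 2 (by omega) (by omega)))
      (stabCoset (⟨0, by omega⟩ : Fin n))
      (schreierMatrix (reducibleSet n 2 (by omega) (by omega))) ∧
    ∃ μ : ℝ, (fullFlagJohnsonGraph n 2).IsSecondLargestEigenvalue μ ∧
      IsSecondLargestEigenvalue (schreierMatrix (reducibleSet n 2 (by omega) (by omega))) μ := by
  classical
  have h2 : 0 < 2 := by omega
  have hn2 : 2 < n := by omega
  set ι := cayleyGraphIso (n := n) h2 hn2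
  have : Nontrivial (Fin n) := Fin.nontrivial_iff_two_le.mpr (by omega)
  obtain ⟨γ, hγ⟩ := exists_isSpectralGap (X := Fin n) (inv_mem_twoNonCuts (n := n))
  set μ : ℝ := (twoNonCuts n).card - γ with hμ
  have hγμ : γ = (twoNonCuts n).card - μ := by rw [hμ]; ring
  have hS : IsSecondLargestEigenvalue (schreierMatrix (reducibleSet n 2 h2 hn2)) μ := by
    rw [schreierMatrix_reducibleSet]
    exact ((isTopNontrivialEigenvalue_iff inv_mem_twoNonCuts μ).mpr
      (hγμ ▸ hγ)).isSecondLargestEigenvalue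
  have hC : IsTopNontrivialEigenvalue ((cayleyGraph (reducibleSet n 2 h2 hn2)).adjMatrix ℝ) μ := by
    have h1 := (isTopNontrivialEigenvalue_iff inv_mem_twoNonCuts μ).mpr (hγμ ▸ hγ.perm hn)
    rw [← adjMatrix_cayleyGraph h2 hn2] at h1
    convert h1
  have hJ : IsTopNontrivialEigenvalue ((fullFlagJohnsonGraph n 2).adjMatrix ℝ) μ := by
    have h1 := hC.submatrix ι.symm.toEquiv
    have h3 : ((cayleyGraph (reducibleSet n 2 h2 hn2)).adjMatrix ℝ).submatrix ι.symm.toEquiv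
        ι.symm.toEquiv = (fullFlagJohnsonGraph n 2).adjMatrix ℝ := by
      ext U V
      rw [Matrix.submatrix_apply, SimpleGraph.adjMatrix_apply, SimpleGraph.adjMatrix_apply]
      congr 1
      exact propext ι.symm.map_adj_iff
    rw [← h3]
    exact h1
  refine ⟨⟨ι.symm⟩, ⟨closure_reducibleSet h2 hn2, μ, ?_, hS⟩, isQuotientMatrix_stabCoset _ _, μ,
    ?_, hS⟩
  · have := hC.isSecondLargestEigenvalue
    unfold SimpleGraph.IsSecondLargestEigenvalue
    convert this
  · have := hJ.isSecondLargestEigenvalue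
    unfold SimpleGraph.IsSecondLargestEigenvalue
    convert this
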